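/- Let $R$ be a commutative ring and let $G$ be a finite directed graph (edges form a subset of $V(G)\times V(G)$). Let $d_G(x,y)\in\mathbb N\cup\{\infty\}$ be the minimal number of edges of a directed path from $x$ to $y$, and put $\mathrm{len}(x_0,\dots,x_k)=\sum_{i<k} d_G(x_i,x_{i+1})$. Definitions. * $\mathbf{Reach}_G$ is the category whose objects are the vertices of $G$, with exactly one morphism $x\to y$ if there is a (possibly constant) directed path from $x$ to $y$, and none otherwise. $N(\mathbf{Reach}_G)$ is its nerve, and the injective nerve $N^\iota(\mathbf{Reach}_G)\subseteq N(\mathbf{Reach}_G)$ is the simplicial subset consisting of the functors $[m]\to\mathbf{Reach}_G$ that are injective on objects and all their degeneracies. Both are filtered by $F_\ell$ = the simplices $(x_0,\dots,x_k)$ with $\mathrm{len}(x_0,\dots,x_k)\le\ell$, and their normalized chain complexes over $R$ are filtered by the images of the normalized chains of $F_\ell$. The spectral sequences of these filtered complexes are the regular magnitude-path spectral sequence $IE$ and the magnitude-path spectral sequence $E$. Here $IE^{\ell,r}_k$ denotes the term on page $r\ge 0$ in filtration degree $\ell$ and chain degree $k$, with differential $IE^{\ell,r}_k\to IE^{\ell-r,r}_{k-1}$;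 explicitly $IE^{\ell,r}_k=Z^r_\ell/(Z^{r-1}_{\ell-1}+\partial Z^{r-1}_{\ell+r-1})$ with $Z^r_\ell=\{x\in F_\ell : \partial x\in F_{\ell-r}\}$. * $\mathrm{EMC}_{k,\ell}(G)$ is the free $R$-module on the tuples $(x_0,\dots,x_k)$ of pairwise distinct vertices with $\mathrm{len}=\ell$, with differential $\sum_{i=1}^{k-1}(-1)^i\partial_i$, where $\partial_i$ omits $x_i$ if this preserves the length and is $0$ otherwise. $\mathrm{EMH}_{k,\ell}(G)=H_k(\mathrm{EMC}_{*,\ell}(G))$ is the eulerian magnitude homology. * Let $\mathcal A^\iota_k$ be the free $R$-module on the tuples $(x_0,\dots,x_k)$ of pairwise distinct vertices such that each $(x_i,x_{i+1})$ is an edge, let $\partial=\sum_{i=0}^k(-1)^i\partial_i$ be the usual boundary on tuples, and let $\Omega^\iota_k=\{u\in\mathcal A^\iota_k : \partial u\in\mathcal A^\iota_{k-1}\}$ (with $\Omega^\iota_0=\mathcal A^\iota_0$). The regular path homology of $G$ is $H_k(\Omega^\iota_*,\partial)$. * $\mathrm{Inj}(G)$, the complex of injective words on $G$, has as $k$-simplices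 the words $x_0\cdots x_k$ of pairwise distinct vertices such that for all $i<j$ there is a directed path from $x_i$ to $x_j$; the faces omit letters. Its homology (over $R$) is that of the free $R$-modules on these words with $\partial=\sum_{i=0}^k(-1)^i\partial_i$. Theorem. 1. For all $k,\ell\ge0$ there is an isomorphism $\mathrm{EMH}_{k,\ell}(G)\cong IE^{\ell,1}_k$, sending the class of a cycle of tuples to the class of the corresponding chain of simplices. 2. For all $k\ge0$ there is an isomorphism between the regular path homology of $G$ in degree $k$ and the diagonal term $IE^{k,2}_k$ of the second page, sending the class of a cycle to the class of the corresponding chain of simplices. 3. The map sending an injective word to the corresponding simplex is an isomorphism from the chain complex of $\mathrm{Inj}(G)$ to the normalized chain complex of $N^\iota(\mathbf{Reach}_G)$, and the spectral sequence $IE$ converges to the homology of $\mathrm{Inj}(G)$. That is, let $\Phi_\ell H_k(\mathrm{Inj}(G))$ be the submodule of the classes represented by cycles of words of length at most $\ell$. This increasing filtration is zero for $\ell<0$ and is all of $H_k(\mathrm{Inj}(G))$ for large $\ell$; for all $\ell,k\ge 0$ the differentials into and out of $IE^{\ell,r}_k$ vanish for all sufficiently large $r$, and the stable value satisfies $IE^{\ell,\infty}_k\cong\Phi_\ell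 H_k(\mathrm{Inj}(G))/\Phi_{\ell-1}H_k(\mathrm{Inj}(G))$. 4. The inclusions $F_\ell N^\iota(\mathbf{Reach}_G)\subseteq F_\ell N(\mathbf{Reach}_G)$ induce a morphism of spectral sequences from $IE$ to the magnitude-path spectral sequence $E$. -/

import Mathlib

open CategoryTheory

universe u

/-- If `φ : Z → S.X₂` takes values in the cycles, hits every homology class, and `N` consists of the
elements which `φ` sends to boundaries, then the homology of `S` is `Z ⧸ N`. The inverse of this
isomorphism sends the class of `z` to the homology class of the cycle `φ z`. -/
noncomputable def ShortComplex.homologyIsoQuotient {R : Type u} [CommRing R]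
    (S : ShortComplex (ModuleCat.{u} R)) {Z : Type u} [AddCommGroup Z] [Module R Z]
    (N : Submodule R Z) (φ : Z →ₗ[R] S.X₂) (h₁ : ∀ z, S.g (φ z) = 0)
    (h₂ : ∀ x, S.g x = 0 → ∃ z y, x = φ z + S.f y)
    (h₃ : ∀ z, z ∈ N ↔ ∃ y, S.f y = φ z) :
    S.homology ≅ ModuleCat.of R (Z ⧸ N) :=
  let ψ : ModuleCat.of R Z ⟶ S.homology :=
    S.liftCycles (ModuleCat.ofHom φ) (by ext z; exact h₁ z) ≫ S.homologyπ
  have hφ : ∀ z, S.iCycles (S.liftCycles (ModuleCat.ofHom φ) (by ext z; exact h₁ z) z) = φ z :=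
    fun z => by
      rw [← ConcreteCategory.comp_apply, S.liftCycles_i]; rfl
  have hinj : Function.Injective S.iCycles := (ModuleCat.mono_iff_injective _).1 inferInstance
  have hf : ∀ y, S.iCycles (S.toCycles y) = S.f y := fun y => by
    rw [← ConcreteCategory.comp_apply, S.toCycles_i]
  have hπf : ∀ y, S.homologyπ (S.toCycles y) = 0 := fun y => by
    rw [← ConcreteCategory.comp_apply, S.toCycles_comp_homologyπ]; rfl
  have hex : ∀ c, S.homologyπ c = 0 → ∃ y, S.toCycles y = c := by
    have := (ShortComplex.exact_of_g_is_cokernel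
      (ShortComplex.mk S.toCycles S.homologyπ S.toCycles_comp_homologyπ) S.homologyIsCokernel)
    exact (ShortComplex.moduleCat_exact_iff _).1 this
  have hsurj : Function.Surjective ψ.hom := by
    intro h
    obtain ⟨c, rfl⟩ := (ModuleCat.epi_iff_surjective S.homologyπ).1 inferInstance h
    obtain ⟨z, y, hz⟩ := h₂ (S.iCycles c) (by
      rw [← ConcreteCategory.comp_apply, S.iCycles_g]; rfl)
    refine ⟨z, ?_⟩
    have : c = S.liftCycles (ModuleCat.ofHom φ) (by ext z; exact h₁ z) z + S.toCycles y := by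
      apply hinj
      rw [map_add, hφ, hf, hz]
    rw [this, map_add, hπf, add_zero]
    rfl
  have hker : N = LinearMap.ker ψ.hom := by
    ext z
    rw [h₃, LinearMap.mem_ker]
    constructor
    · rintro ⟨y, hy⟩
      have : S.liftCycles (ModuleCat.ofHom φ) (by ext z; exact h₁ z) z = S.toCycles y := by
        apply hinj
        rw [hφ, hf, hy]
      change S.homologyπ (S.liftCycles (ModuleCat.ofHom φ) _ z) = 0
      rw [this, hπf]
    · intro h
      obtain ⟨y, hy⟩ := hex _ h
      exact ⟨y, by rw [← hf, hy]; exact hφ z⟩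
  ((Submodule.quotEquivOfEq _ _ hker).trans
    (ψ.hom.quotKerEquivOfSurjective hsurj)).toModuleIso.symm

/-- A chain complex of `R`-modules with an increasing filtration by subcomplexes which vanishes in
negative filtration degrees. -/
structure FilteredComplex (R : Type u) [CommRing R] where
  C : ChainComplex (ModuleCat.{u} R) ℕ
  F : ℤ → ∀ k : ℕ, Submodule R (C.X k)
  mono : ∀ {p q : ℤ}, p ≤ q → ∀ k, F p k ≤ F q k
  d_mem : ∀ (p : ℤ) (i j : ℕ) (x : C.X i), x ∈ F p i → C.d i j x ∈ F p j
  neg : ∀ (p : ℤ) (k : ℕ), p < 0 → F p k = ⊥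

namespace FilteredComplex

variable {R : Type u} [CommRing R]

/-- `Z^r_p = {x ∈ F_p C_k | dx ∈ F_{p-r} C_{k-1}}` (no condition on `dx` if `k = 0`). -/
def Z (A : FilteredComplex R) (r p : ℤ) (k : ℕ) : Submodule R (A.C.X k) where
  carrier := {x | x ∈ A.F p k ∧ ∀ j, A.C.d k j x ∈ A.F (p - r) j}
  add_mem' {x y} hx hy := ⟨add_mem hx.1 hy.1, fun j => by
    rw [map_add]; exact add_mem (hx.2 j) (hy.2 j)⟩
  zero_mem' := ⟨zero_mem _, fun j => by rw [map_zero]; exact zero_mem _⟩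
  smul_mem' a x hx := ⟨Submodule.smul_mem _ a hx.1, fun j => by
    rw [map_smul]; exact Submodule.smul_mem _ a (hx.2 j)⟩

/-- `B^r_p = Z^{r-1}_{p-1} + d Z^{r-1}_{p+r-1}`. -/
def B (A : FilteredComplex R) (r p : ℤ) (k : ℕ) : Submodule R (A.C.X k) :=
  A.Z (r - 1) (p - 1) k ⊔ (A.Z (r - 1) (p + r - 1) (k + 1)).map (A.C.d (k + 1) k).hom

/-- `E^r_{p,k} = Z^r_p / B^r_p`; here `p` is the filtration degree and `k` the chain degree. -/
abbrev E (A : FilteredComplex R) (r p : ℤ) (k : ℕ) : Type u :=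
  A.Z r p k ⧸ (A.B r p k).comap (A.Z r p k).subtype

/-- The class in `E^r_{p,k}` of an element of `Z^r_p`. -/
abbrev cls (A : FilteredComplex R) (r p : ℤ) (k : ℕ) : A.Z r p k →ₗ[R] A.E r p k :=
  Submodule.mkQ _

lemma d_d (A : FilteredComplex R) (i j l : ℕ) (x : A.C.X i) : A.C.d j l (A.C.d i j x) = 0 := by
  rw [← ConcreteCategory.comp_apply, A.C.d_comp_d]; rfl

lemma d_mem_Z (A : FilteredComplex R) {r p q : ℤ} {i j : ℕ} (h : p - r = q)
    {x : A.C.X i} (hx : x ∈ A.Z r p i) (s : ℤ) : A.C.d i j x ∈ A.Z s q j :=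
  ⟨h ▸ hx.2 j, fun l => by rw [A.d_d]; exact zero_mem _⟩

lemma d_mem_B (A : FilteredComplex R) {r p q : ℤ} {i j : ℕ} (h : p - r = q)
    {x : A.C.X i} (hx : x ∈ A.B r p i) : A.C.d i j x ∈ A.B r q j := by
  obtain ⟨y, hy, z, ⟨w, -, rfl⟩, rfl⟩ := Submodule.mem_sup.1 hx
  rw [map_add]
  have h0 : A.C.d i j ((A.C.d (i + 1) i).hom w) = 0 := A.d_d _ _ _ w
  rw [h0, add_zero]
  by_cases hij : j + 1 = i
  · subst hij
    refine Submodule.mem_sup_right ⟨y, ?_, rfl⟩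
    rwa [show q + r - 1 = p - 1 by omega]
  · rw [A.C.shape i j hij]; exact zero_mem _

/-- The differential `E^r_{p,k} → E^r_{p-r,k-1}` induced by the differential of the complex. -/
def dE (A : FilteredComplex R) (r p q : ℤ) (i j : ℕ) (h : p - r = q) : A.E r p i →ₗ[R] A.E r q j :=
  Submodule.mapQ _ _
    ((A.C.d i j).hom.restrict (fun _ hx => A.d_mem_Z h hx r))
    (fun _ hx => A.d_mem_B h hx)

/-- The shape of the `r`-th page: the differential goes from `(p, k)` to `(p - r, k - 1)`. -/
abbrev pageShape (r : ℤ) : ComplexShape (ℕ × ℕ) :=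
  ComplexShape.spectralSequenceNat (-r, -1)

open Classical in
/-- The `r`-th page of the spectral sequence of a filtered complex. -/
noncomputable def page (A : FilteredComplex R) (r : ℤ) :
    HomologicalComplex (ModuleCat.{u} R) (pageShape r) where
  X pk := ModuleCat.of R (A.E r pk.1 pk.2)
  d i j := if h : (pageShape r).Rel i j then
    ModuleCat.ofHom (A.dE r i.1 j.1 i.2 j.2 (by have := h.1; omega)) else 0
  shape i j h := dif_neg h
  d_comp_d' i j k hij hjk := by
    rw [dif_pos hij, dif_pos hjk]
    ext x
    change A.cls _ _ _ ⟨A.C.d j.2 k.2 (A.C.d i.2 j.2 x.1), _⟩ = 0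
    refine (Submodule.Quotient.mk_eq_zero _).2 ?_
    change A.C.d j.2 k.2 (A.C.d i.2 j.2 x.1) ∈ A.B r k.1 k.2
    rw [A.d_d]; exact zero_mem _

lemma page_d_apply (A : FilteredComplex R) (r : ℤ) (i j : ℕ × ℕ) (h : (pageShape r).Rel i j)
    (x : A.Z r i.1 i.2) :
    (A.page r).d i j (A.cls r i.1 i.2 x) = A.cls r j.1 j.2
      ⟨A.C.d i.2 j.2 x.1, A.d_mem_Z (by have := h.1; omega) x.2 r⟩ := by
  simp only [page]
  rw [dif_pos h]
  rfl

lemma Z_mono (A : FilteredComplex R) {r p r' p' : ℤ} (h : p ≤ p') (h' : p - r ≤ p' - r') (k : ℕ) :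
    A.Z r p k ≤ A.Z r' p' k :=
  fun _ hx => ⟨A.mono h k hx.1, fun j => A.mono h' j (hx.2 j)⟩

/-- The homology of the `r`-th page is the page `r + 1`. -/
noncomputable def pageIso (A : FilteredComplex R) (r r' : ℤ) (pk : ℕ × ℕ) (hrr' : r + 1 = r')
    (hr : 0 ≤ r) : (A.page r).homology pk ≅ (A.page r').X pk :=
  ShortComplex.homologyIsoQuotient ((A.page r).sc pk) _
    ((A.cls r pk.1 pk.2).comp (Submodule.inclusion
      (A.Z_mono (r := r') (p := pk.1) (r' := r) (by omega) (by omega) pk.2)))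
    (by
      intro z
      change (A.page r).d pk ((pageShape r).next pk) (A.cls r pk.1 pk.2 _) = 0
      by_cases h : (pageShape r).Rel pk ((pageShape r).next pk)
      · rw [A.page_d_apply r _ _ h]
        refine (Submodule.Quotient.mk_eq_zero _).2 (Submodule.mem_sup_left ?_)
        exact A.d_mem_Z (by have := h.1; simp only at this; omega) z.2 _
      · rw [(A.page r).shape _ _ h]; rfl)
    (by
      intro x hx
      obtain ⟨x, rfl⟩ := Submodule.mkQ_surjective _ x
      change (A.page r).d pk ((pageShape r).next pk) (A.cls r pk.1 pk.2 x) = 0 at hx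
      -- it suffices to change `x` by an element of `B`
      suffices h : ∃ b ∈ A.B r pk.1 pk.2, x.1 - b ∈ A.Z r' pk.1 pk.2 by
        obtain ⟨b, hb, hxb⟩ := h
        refine ⟨⟨_, hxb⟩, 0, ?_⟩
        rw [map_zero, add_zero]
        refine ((Submodule.Quotient.eq _).2 ?_)
        change x.1 - (x.1 - b) ∈ A.B r pk.1 pk.2
        rwa [sub_sub_cancel]
      by_cases h : (pageShape r).Rel pk ((pageShape r).next pk)
      · rw [A.page_d_apply r _ _ h] at hx
        have hx := (Submodule.Quotient.mk_eq_zero _).1 hx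
        obtain ⟨h1, h2⟩ := h
        simp only at h1 h2
        generalize (pageShape r).next pk = qj at *
        obtain ⟨q, j⟩ := qj
        obtain ⟨p, k⟩ := pk
        simp only at h1 h2 hx x ⊢
        obtain rfl : k = j + 1 := by omega
        obtain ⟨a, ha, _, ⟨b, hb, rfl⟩, hab⟩ := Submodule.mem_sup.1 hx
        change a + A.C.d (j + 1) j b = A.C.d (j + 1) j x.1 at hab
        refine ⟨b, Submodule.mem_sup_left ?_, ?_⟩
        · rwa [show (p : ℤ) - 1 = q + r - 1 by omega]
        · refine ⟨sub_mem x.2.1 (A.mono (by omega) _ hb.1), fun l => ?_⟩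
          by_cases hl : l = j
          · subst hl
            rw [map_sub, ← hab, add_sub_cancel_right, show (p : ℤ) - r' = q - 1 by omega]
            exact ha.1
          · rw [A.C.shape _ _ (by simp [ComplexShape.down]; omega)]; exact zero_mem _
      · refine ⟨0, zero_mem _, ?_⟩
        rw [sub_zero]
        refine ⟨x.2.1, fun l => ?_⟩
        by_cases hl : l + 1 = pk.2
        · have hneg : (pk.1 : ℤ) - r < 0 := by
            by_contra hcon
            refine h ?_
            have hrel : (pageShape r).Rel pk (((pk.1 : ℤ) - r).toNat, l) :=
              ⟨by simp only; omega, by simp only; omega⟩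
            rwa [(pageShape r).next_eq' hrel]
          have := x.2.2 l
          rw [A.neg _ _ hneg] at this
          rw [(Submodule.mem_bot R).1 this]; exact zero_mem _
        · rw [A.C.shape _ _ hl]; exact zero_mem _)
    (by
      intro z
      have hrel : (pageShape r).Rel (((pk.1 : ℤ) + r).toNat, pk.2 + 1) pk :=
        ⟨by simp only; omega, by simp only; omega⟩
      have hp : ((((pk.1 : ℤ) + r).toNat : ℕ) : ℤ) = pk.1 + r := by omega
      have key : (∃ y, (A.page r).d (((pk.1 : ℤ) + r).toNat, pk.2 + 1) pk y =
          A.cls r pk.1 pk.2 (Submodule.inclusion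
            (A.Z_mono (r := r') (p := pk.1) (r' := r) (by omega) (by omega) pk.2) z)) ↔
          ∃ y ∈ A.Z r (pk.1 + r) (pk.2 + 1), A.C.d (pk.2 + 1) pk.2 y - z.1 ∈ A.B r pk.1 pk.2 := by
        constructor
        · rintro ⟨y, hy⟩
          obtain ⟨y, rfl⟩ := Submodule.mkQ_surjective _ y
          rw [A.page_d_apply r _ _ hrel] at hy
          have hy := (Submodule.Quotient.eq _).1 hy
          exact ⟨y.1, A.Z_mono hp.le (by omega) _ y.2, hy⟩
        · rintro ⟨y, hy, hyz⟩
          refine ⟨A.cls r _ _ ⟨y, by rw [hp]; exact hy⟩, ?_⟩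
          rw [A.page_d_apply r _ _ hrel]
          exact (Submodule.Quotient.eq _).2 hyz
      change z.1 ∈ A.B r' pk.1 pk.2 ↔ ∃ y, (A.page r).d ((pageShape r).prev pk) pk y = _
      rw [(pageShape r).prev_eq' hrel]
      refine Iff.trans ?_ key.symm
      constructor
      · intro hz
        obtain ⟨a, ha, _, ⟨y, hy, rfl⟩, hay⟩ := Submodule.mem_sup.1 hz
        change a + A.C.d (pk.2 + 1) pk.2 y = z.1 at hay
        refine ⟨y, A.Z_mono (by omega) (by omega) _ hy, Submodule.mem_sup_left ?_⟩
        rw [← hay, sub_add_cancel_right]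
        exact neg_mem (A.Z_mono (by omega) (by omega) _ ha)
      · rintro ⟨y, hy, hyz⟩
        obtain ⟨a, ha, _, ⟨w, hw, rfl⟩, haw⟩ := Submodule.mem_sup.1 hyz
        change a + A.C.d (pk.2 + 1) pk.2 w = A.C.d (pk.2 + 1) pk.2 y - z.1 at haw
        have hz : z.1 = -a + A.C.d (pk.2 + 1) pk.2 (y - w) := by
          rw [map_sub, eq_sub_of_add_eq' haw]
          abel
        have hd : A.C.d (pk.2 + 1) pk.2 (y - w) ∈ A.Z r' pk.1 pk.2 :=
          A.d_mem_Z (r := r) (p := pk.1 + r) (by omega)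
            (sub_mem hy (A.Z_mono (by omega) (by omega) _ hw)) r'
        have ha' : -a ∈ A.Z r' pk.1 pk.2 := by
          have := sub_mem z.2 hd
          rwa [hz, add_sub_cancel_right] at this
        rw [hz]
        refine add_mem (Submodule.mem_sup_left ⟨neg_mem ha.1, fun j => ?_⟩)
          (Submodule.mem_sup_right ⟨y - w, ?_, rfl⟩)
        · rw [show (pk.1 : ℤ) - 1 - (r' - 1) = pk.1 - r' by omega]
          exact ha'.2 j
        · exact sub_mem (A.Z_mono (by omega) (by omega) _ hy)
            (A.Z_mono (by omega) (by omega) _ hw))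

/-- The spectral sequence of a filtered complex. -/
noncomputable def spectralSequence (A : FilteredComplex R) :
    SpectralSequence (ModuleCat.{u} R) pageShape 0 where
  page r _ := A.page r
  iso r r' pk hrr' hr := A.pageIso r r' pk hrr' hr

end FilteredComplex

/-! ## Digraphs, distances and lengths of tuples -/

namespace Digraph

variable {V : Type u}

/-- `G.HasWalk n x y`: there is a directed path with `n` edges from `x` to `y` in `G`. -/
inductive HasWalk (G : Digraph V) : ℕ → V → V → Prop
  | nil (x : V) : HasWalk G 0 x x
  | cons {n : ℕ} {x y z : V} (h : G.Adj x y) (w : HasWalk G n y z) : HasWalk G (n + 1) x z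

/-- There is a directed path (possibly the constant one) from `x` to `y`. -/
def Reachable (G : Digraph V) (x y : V) : Prop := ∃ n, G.HasWalk n x y

/-- The directed distance: the minimal length of a directed path from `x` to `y`, and `⊤` if there
is none. -/
noncomputable def edist (G : Digraph V) (x y : V) : ℕ∞ := ⨅ (n : ℕ) (_ : G.HasWalk n x y), (n : ℕ∞)

/-- The length `∑ d(x_i, x_{i+1})` of a tuple `(x_0, …, x_k)`. -/
noncomputable def len (G : Digraph V) {k : ℕ} (x : Fin (k + 1) → V) : ℕ∞ :=
  ∑ i : Fin k, G.edist (x i.castSucc) (x i.succ)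

lemma HasWalk.append {G : Digraph V} {m n : ℕ} {x y z : V} (h : G.HasWalk m x y)
    (h' : G.HasWalk n y z) : G.HasWalk (m + n) x z := by
  induction h with
  | nil x => simpa using h'
  | cons e _ ih => rw [Nat.add_right_comm]; exact .cons e (ih h')

lemma edist_le {G : Digraph V} {n : ℕ} {x y : V} (h : G.HasWalk n x y) : G.edist x y ≤ n :=
  iInf₂_le n h

lemma edist_self (G : Digraph V) (x : V) : G.edist x x = 0 := by
  simpa using edist_le (HasWalk.nil (G := G) x)

lemma exists_hasWalk_of_edist_ne_top {G : Digraph V} {x y : V} (h : G.edist x y ≠ ⊤) :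
    ∃ n, G.HasWalk n x y ∧ G.edist x y = n := by
  classical
  have hex : ∃ n, G.HasWalk n x y := by
    by_contra hcon
    push Not at hcon
    exact h (by simp [edist, hcon])
  refine ⟨Nat.find hex, Nat.find_spec hex, le_antisymm (edist_le (Nat.find_spec hex)) ?_⟩
  exact le_iInf₂ fun n hn => by exact_mod_cast Nat.find_min' hex hn

lemma edist_triangle (G : Digraph V) (x y z : V) :
    G.edist x z ≤ G.edist x y + G.edist y z := by
  by_cases h : G.edist x y = ⊤
  · simp [h]
  by_cases h' : G.edist y z = ⊤
  · simp [h']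
  obtain ⟨m, hm, em⟩ := exists_hasWalk_of_edist_ne_top h
  obtain ⟨n, hn, en⟩ := exists_hasWalk_of_edist_ne_top h'
  rw [em, en]
  exact_mod_cast edist_le (hm.append hn)

lemma edist_ne_zero {G : Digraph V} {x y : V} (h : x ≠ y) : G.edist x y ≠ 0 := by
  intro h0
  obtain ⟨n, hn, en⟩ := exists_hasWalk_of_edist_ne_top (G := G) (x := x) (y := y) (by simp [h0])
  rw [h0] at en
  obtain rfl : n = 0 := by exact_mod_cast en.symm
  cases hn
  exact h rfl

/-- Passing to a subtuple, possibly with repetitions, does not increase the length. -/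
lemma len_comp_le (G : Digraph V) {m n : ℕ} (x : Fin (n + 1) → V) (σ : Fin (m + 1) → Fin (n + 1))
    (hσ : Monotone σ) : G.len (x ∘ σ) ≤ G.len x := by
  let y : ℕ → V := fun t => x ⟨min t n, by omega⟩
  let P : ℕ → ℕ∞ := fun t => ∑ i ∈ Finset.range t, G.edist (y i) (y (i + 1))
  have hy : ∀ i : Fin (n + 1), y i = x i := fun i => congrArg x (Fin.ext (by simp; omega))
  have hP : ∀ a b, a ≤ b → P a + G.edist (y a) (y b) ≤ P b := by
    intro a b hab
    induction b, hab using Nat.le_induction with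
    | base => simp [edist_self]
    | succ b hb ih =>
      calc P a + G.edist (y a) (y (b + 1))
          ≤ P a + (G.edist (y a) (y b) + G.edist (y b) (y (b + 1))) := by
            gcongr; exact G.edist_triangle _ _ _
        _ ≤ P b + G.edist (y b) (y (b + 1)) := by rw [← add_assoc]; gcongr
        _ = P (b + 1) := (Finset.sum_range_succ _ _).symm
  have hPm : ∀ a b, a ≤ b → P a ≤ P b := fun a b h => le_self_add.trans (hP a b h)
  have hlen : G.len x = P n := by
    simp only [len, P]
    rw [← Fin.sum_univ_eq_sum_range (fun i => G.edist (y i) (y (i + 1)))]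
    refine Finset.sum_congr rfl fun i _ => ?_
    rw [← hy i.castSucc, ← hy i.succ]; rfl
  let τ : ℕ → ℕ := fun t => (σ ⟨min t m, by omega⟩ : ℕ)
  have hτ : ∀ a b, a ≤ b → τ a ≤ τ b := fun a b h => hσ (by simp [Fin.le_def]; omega)
  have hind : ∀ t, ∑ i ∈ Finset.range t, G.edist (y (τ i)) (y (τ (i + 1))) ≤ P (τ t) := by
    intro t
    induction t with
    | zero => simp
    | succ t ih =>
      rw [Finset.sum_range_succ]
      exact (add_le_add_left ih _).trans (hP _ _ (hτ _ _ (Nat.le_succ t)))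
  rw [hlen]
  calc G.len (x ∘ σ) = ∑ i ∈ Finset.range m, G.edist (y (τ i)) (y (τ (i + 1))) := by
        rw [← Fin.sum_univ_eq_sum_range (fun i => G.edist (y (τ i)) (y (τ (i + 1))))]
        refine Finset.sum_congr rfl fun i _ => ?_
        have h1 : σ i.castSucc = σ ⟨min i m, by omega⟩ := congrArg σ (Fin.ext (by simp))
        have h2 : σ i.succ = σ ⟨min (i + 1) m, by omega⟩ := congrArg σ (Fin.ext (by simp))
        simp only [Function.comp, τ, hy, h1, h2]
    _ ≤ P (τ m) := hind m
    _ ≤ P n := hPm _ _ (by simp only [τ]; omega)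

lemma Reachable.refl (G : Digraph V) (x : V) : G.Reachable x x := ⟨0, .nil x⟩

lemma Reachable.trans {G : Digraph V} {x y z : V} (h : G.Reachable x y) (h' : G.Reachable y z) :
    G.Reachable x z :=
  let ⟨m, hm⟩ := h
  let ⟨n, hn⟩ := h'
  ⟨m + n, hm.append hn⟩

/-! ## The reachability category and its nerves -/

/-- The reachability category of `G`: its objects are the vertices, and there is exactly one
morphism from `x` to `y` if there is a directed path from `x` to `y`, and none otherwise. -/
def Reach (_ : Digraph V) : Type u := V

instance (G : Digraph V) : Preorder G.Reach where
  le x y := G.Reachable x y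
  le_refl := Reachable.refl G
  le_trans _ _ _ := Reachable.trans

end Digraph

/-- The injective nerve of a category: the simplicial subset of the nerve whose simplices are the
functors `[m] → C` which are injective on objects and all their degeneracies. (Faces of functors
which are injective on objects are again such, so allowing all `σ : [n] → [m]` adds nothing to
the surjective ones.) -/
def injectiveNerve (C : Type u) [Category.{u} C] : (nerve C).Subcomplex where
  obj Δ := {s | ∃ (m : SimplexCategory) (t : (nerve C).obj (.op m)) (σ : Δ.unop ⟶ m),
    Function.Injective t.obj ∧ s = (nerve C).map σ.op t}
  map {Δ Δ'} f := by
    rintro _ ⟨m, t, σ, ht, rfl⟩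
    exact ⟨m, t, f.unop ≫ σ, ht, by rw [op_comp, Functor.map_comp_apply]; rfl⟩

namespace Digraph

variable {V : Type u}

/-- The filtration step `F_p` of the nerve of the reachability category: the simplices
`(x_0, …, x_k)` of length at most `p`. It is empty for `p < 0`. -/
def lengthFiltration (G : Digraph V) (p : ℤ) : (nerve G.Reach).Subcomplex where
  obj Δ := {s | ∃ n : ℕ, G.len (V := V) s.obj ≤ n ∧ (n : ℤ) ≤ p}
  map {Δ Δ'} f := by
    rintro s ⟨n, hn, hp⟩
    exact ⟨n, (G.len_comp_le (V := V) s.obj f.unop.toOrderHom f.unop.toOrderHom.monotone).trans hn,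
      hp⟩

/-- The filtration step `F_p` of the injective nerve of the reachability category. -/
def injLengthFiltration (G : Digraph V) (p : ℤ) :
    (injectiveNerve G.Reach : SSet.{u}).Subcomplex :=
  (G.lengthFiltration p).preimage (injectiveNerve G.Reach).ι

end Digraph

/-! ## The filtered normalized chain complexes and their spectral sequences -/

namespace FilteredComplex

variable (R : Type u) [CommRing R]

/-- The normalized chain complex `N(X)` of a filtered simplicial set `X`, filtered by the images of
`N(F_p X) → N(X)`. -/
noncomputable def ofSSet (X : SSet.{u}) (F : ℤ → X.Subcomplex) (hF : Monotone F)
    (hF₀ : ∀ p < 0, F p = ⊥) : FilteredComplex R where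
  C := X.normalizedChainComplex (ModuleCat.of R R)
  F p k := LinearMap.range ((SSet.normalizedChainComplexMap (F p).ι (ModuleCat.of R R)).f k).hom
  mono {p q} hpq k := by
    rintro _ ⟨x, rfl⟩
    refine ⟨(SSet.normalizedChainComplexMap (SSet.Subcomplex.homOfLE (hF hpq))
      (ModuleCat.of R R)).f k x, ?_⟩
    have h := (SSet.normalizedChainComplexFunctorObj (ModuleCat.of R R)).map_comp
      (SSet.Subcomplex.homOfLE (hF hpq)) (F q).ι
    have h' := congrArg (fun φ => φ.f k x) h
    exact h'.symm
  d_mem p i j := by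
    rintro _ ⟨x, rfl⟩
    refine ⟨((F p : SSet.{u}).normalizedChainComplex (ModuleCat.of R R)).d i j x, ?_⟩
    have h := (SSet.normalizedChainComplexMap (F p).ι (ModuleCat.of R R)).comm i j
    exact (congrArg (fun φ => φ x) h).symm
  neg p k hp := by
    have h : (SSet.normalizedChainComplexMap (F p).ι (ModuleCat.of R R)).f k = 0 := by
      apply SSet.normalizedChainComplex_hom_ext
      rintro ⟨x, hx⟩
      rw [hF₀ p hp] at hx
      exact hx.elim
    rw [h]
    exact LinearMap.range_zero

variable {R}

/-- A chain map which preserves the filtrations. -/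
structure Hom (A A' : FilteredComplex R) where
  f : A.C ⟶ A'.C
  map_mem : ∀ (p : ℤ) (k : ℕ) (x : A.C.X k), x ∈ A.F p k → f.f k x ∈ A'.F p k

/-- A filtered chain map sends `Z^r_p` to `Z^r_p`. -/
noncomputable def Hom.mapZ {A A' : FilteredComplex R} (φ : Hom A A') (r p : ℤ) (k : ℕ) :
    A.Z r p k →ₗ[R] A'.Z r p k :=
  (φ.f.f k).hom.restrict fun x hx => ⟨φ.map_mem p k x hx.1, fun j => by
    have h := congrArg (fun ψ => ψ x) (φ.f.comm k j)
    change A'.C.d k j (φ.f.f k x) = φ.f.f j (A.C.d k j x) at h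
    change A'.C.d k j (φ.f.f k x) ∈ _
    rw [h]
    exact φ.map_mem _ _ _ (hx.2 j)⟩

end FilteredComplex

namespace Digraph

variable {V : Type u} (R : Type u) [CommRing R]

lemma lengthFiltration_mono (G : Digraph V) : Monotone G.lengthFiltration := by
  rintro p q hpq Δ s ⟨n, hn, hp⟩
  exact ⟨n, hn, hp.trans hpq⟩

lemma lengthFiltration_neg (G : Digraph V) (p : ℤ) (hp : p < 0) : G.lengthFiltration p = ⊥ := by
  ext Δ s
  refine ⟨?_, fun h => h.elim⟩
  rintro ⟨n, -, hn⟩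
  omega

/-- The normalized chains of the nerve of the reachability category, with the length filtration. -/
noncomputable def nerveComplex (G : Digraph V) : FilteredComplex R :=
  .ofSSet R (nerve G.Reach) G.lengthFiltration G.lengthFiltration_mono G.lengthFiltration_neg

/-- The normalized chains of the injective nerve of the reachability category, with the length
filtration. -/
noncomputable def injNerveComplex (G : Digraph V) : FilteredComplex R :=
  .ofSSet R (injectiveNerve G.Reach) G.injLengthFiltration
    (fun _ _ h _ _ hs => G.lengthFiltration_mono h _ hs)
    (fun p hp => by unfold injLengthFiltration; rw [G.lengthFiltration_neg p hp]; rfl)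

/-- The magnitude-path spectral sequence. -/
noncomputable def magnitudePathSS (G : Digraph V) :
    SpectralSequence (ModuleCat.{u} R) FilteredComplex.pageShape 0 :=
  (G.nerveComplex R).spectralSequence

/-- The regular magnitude-path spectral sequence. -/
noncomputable def regularMagnitudePathSS (G : Digraph V) :
    SpectralSequence (ModuleCat.{u} R) FilteredComplex.pageShape 0 :=
  (G.injNerveComplex R).spectralSequence

/-- The filtered chain map induced by the inclusions `F_p N^ι(Reach_G) ⊆ F_p N(Reach_G)`. -/
noncomputable def inclusionHom (G : Digraph V) :
    FilteredComplex.Hom (G.injNerveComplex R) (G.nerveComplex R) where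
  f := SSet.normalizedChainComplexMap (injectiveNerve G.Reach).ι (ModuleCat.of R R)
  map_mem p k := by
    rintro _ ⟨x, rfl⟩
    let g : (G.injLengthFiltration p : SSet.{u}) ⟶ (G.lengthFiltration p : SSet.{u}) :=
      SSet.Subcomplex.lift ((G.injLengthFiltration p).ι ≫ (injectiveNerve G.Reach).ι)
        (by rintro Δ _ ⟨y, rfl⟩; exact y.2)
    refine ⟨(SSet.normalizedChainComplexMap g (ModuleCat.of R R)).f k x, ?_⟩
    have h := (SSet.normalizedChainComplexFunctorObj (ModuleCat.of R R)).map_comp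
      g (G.lengthFiltration p).ι
    have h' := (SSet.normalizedChainComplexFunctorObj (ModuleCat.of R R)).map_comp
      (G.injLengthFiltration p).ι (injectiveNerve G.Reach).ι
    have h₁ := congrArg (fun φ => φ.f k x) h
    have h₂ := congrArg (fun φ => φ.f k x) h'
    exact h₁.symm.trans h₂

/-! ## Chain complexes of tuples of vertices -/

/-- The free module on all `(k+1)`-tuples of vertices. -/
abbrev Tuples (V R : Type u) [CommRing R] (k : ℕ) : Type u := (Fin (k + 1) → V) →₀ R

/-- The boundary `∑ (-1)^i ∂_i`, where `∂_i` forgets the `i`-th entry. -/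
noncomputable def boundary (V R : Type u) [CommRing R] (k : ℕ) :
    Tuples V R (k + 1) →ₗ[R] Tuples V R k :=
  Finsupp.linearCombination R fun x =>
    ∑ i : Fin (k + 2), (-1 : R) ^ (i : ℕ) • Finsupp.single (x ∘ i.succAbove) 1

lemma boundary_single (k : ℕ) (x : Fin (k + 2) → V) :
    boundary V R k (Finsupp.single x 1) =
      ∑ i : Fin (k + 2), (-1 : R) ^ (i : ℕ) • Finsupp.single (x ∘ i.succAbove) 1 := by
  simp [boundary]

lemma boundary_boundary (k : ℕ) (c : Tuples V R (k + 2)) :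
    boundary V R k (boundary V R (k + 1) c) = 0 := by
  suffices h : (boundary V R k).comp (boundary V R (k + 1)) = 0 from LinearMap.congr_fun h c
  refine Finsupp.lhom_ext' fun x => LinearMap.ext_ring ?_
  change boundary V R k (boundary V R (k + 1) (Finsupp.single x 1)) = 0
  rw [boundary_single, map_sum]
  simp only [map_smul, boundary_single, Finset.smul_sum, smul_smul]
  rw [Finset.sum_comm, ← Finset.sum_product']
  let P := Fin (k + 2) × Fin (k + 3)
  let S : Finset P := {ij : P | (ij.2 : ℕ) ≤ (ij.1 : ℕ)}
  rw [Finset.univ_product_univ, ← Finset.sum_add_sum_compl S, ← eq_neg_iff_add_eq_zero,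
    ← Finset.sum_neg_distrib]
  let φ : ∀ ij : P, ij ∈ S → P := fun ij hij =>
    (Fin.castLT ij.2 (lt_of_le_of_lt (Finset.mem_filter.mp hij).right (Fin.is_lt ij.1)), ij.1.succ)
  apply Finset.sum_bij φ
  · intro ij hij
    simp_rw [S, φ, Finset.compl_filter, Finset.mem_filter_univ, Fin.val_succ,
      Fin.val_castLT] at hij ⊢
    lia
  · rintro ⟨i, j⟩ hij ⟨i', j'⟩ hij' h
    rw [Prod.mk_inj]
    exact ⟨by simpa [φ] using! congr_arg Prod.snd h,
      by simpa [φ, Fin.castSucc_castLT] using! congr_arg Fin.castSucc (congr_arg Prod.fst h)⟩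
  · rintro ⟨i', j'⟩ hij'
    simp_rw [S, Finset.compl_filter, Finset.mem_filter_univ, not_le] at hij'
    refine ⟨(j'.pred <| ?_, Fin.castSucc i'), ?_, ?_⟩
    · rintro rfl
      simp only [Fin.val_zero, not_lt_zero] at hij'
    · simpa [S] using! Nat.le_sub_one_of_lt hij'
    · simp only [φ, Fin.castLT_castSucc, Fin.succ_pred]
  · rintro ⟨i, j⟩ hij
    have hij : (j : ℕ) ≤ i := by simpa [S] using! hij
    have hx : (x ∘ j.succAbove) ∘ i.succAbove =
        (x ∘ i.succ.succAbove) ∘ (Fin.castLT j (by omega) : Fin (k + 2)).succAbove := by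
      funext t
      simp only [Function.comp]
      congr 1
      ext
      have hv : ∀ {n : ℕ} (p : Fin (n + 1)) (q : Fin n),
          (p.succAbove q : ℕ) = if (q : ℕ) < p then (q : ℕ) else q + 1 := fun p q => by
        simp only [Fin.succAbove, Fin.lt_def, Fin.val_castSucc]
        split_ifs <;> rfl
      simp only [hv, Fin.val_succ, Fin.val_castLT]
      split_ifs <;> omega
    simp only [φ, Fin.val_succ, Fin.val_castLT, hx, ← neg_smul]
    congr 1
    ring

/-- The chain complex with `M k ⊆ Tuples V R k` in degree `k` and differential the restriction of
`D`. -/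
noncomputable def tupleComplex {V R : Type u} [CommRing R] (M : ∀ k, Submodule R (Tuples V R k))
    (D : ∀ k, Tuples V R (k + 1) →ₗ[R] Tuples V R k) (hD : ∀ k, ∀ c ∈ M (k + 1), D k c ∈ M k)
    (hDD : ∀ k, ∀ c ∈ M (k + 2), D k (D (k + 1) c) = 0) : ChainComplex (ModuleCat.{u} R) ℕ :=
  ChainComplex.of (fun k => ModuleCat.of R (M k)) (fun k => ModuleCat.ofHom ((D k).restrict (hD k)))
    (fun k => by
      refine ModuleCat.hom_ext (LinearMap.ext fun c => Subtype.ext ?_)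
      exact hDD k c.1 c.2)

lemma boundary_mem_supported {P : ∀ k, Set (Fin (k + 1) → V)}
    (hP : ∀ k, ∀ x ∈ P (k + 1), ∀ i : Fin (k + 2), x ∘ i.succAbove ∈ P k) (k : ℕ)
    (c : Tuples V R (k + 1)) (hc : c ∈ Finsupp.supported R R (P (k + 1))) :
    boundary V R k c ∈ Finsupp.supported R R (P k) := by
  rw [Finsupp.supported_eq_span_single] at hc
  refine Submodule.span_induction (p := fun c _ => boundary V R k c ∈ Finsupp.supported R R (P k))
    ?_ ?_ ?_ ?_ hc
  · rintro _ ⟨x, hx, rfl⟩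
    rw [boundary_single]
    exact Submodule.sum_mem _ fun i _ => Submodule.smul_mem _ _
      (Finsupp.single_mem_supported R _ (hP k x hx i))
  · rw [map_zero]; exact zero_mem _
  · intro a b _ _ ha hb; rw [map_add]; exact add_mem ha hb
  · intro t a _ ha; rw [map_smul]; exact Submodule.smul_mem _ _ ha

/-- Injective words on `G`: tuples of pairwise distinct vertices such that there is a directed path
from `x_i` to `x_j` whenever `i < j`. -/
def IsInjWord (G : Digraph V) {k : ℕ} (x : Fin (k + 1) → V) : Prop :=
  Function.Injective x ∧ ∀ i j, i < j → G.Reachable (x i) (x j)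

/-- The chain complex of the complex of injective words `Inj(G)`, whose `k`-simplices are the
injective words with `k + 1` letters and whose faces are given by forgetting letters. -/
noncomputable def injWordsComplex (G : Digraph V) : ChainComplex (ModuleCat.{u} R) ℕ :=
  tupleComplex (fun _ => Finsupp.supported R R {x : Fin _ → V | G.IsInjWord x}) (boundary V R)
    (boundary_mem_supported R fun _ _ hx i =>
      ⟨hx.1.comp Fin.succAbove_right_injective,
        fun _ _ h => hx.2 _ _ (Fin.strictMono_succAbove i h)⟩)
    (fun k c _ => boundary_boundary R k c)

/-- Strongly regular allowed elementary paths: tuples of pairwise distinct vertices with an edge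
from each vertex to the next. -/
def IsStronglyRegularPath (G : Digraph V) {k : ℕ} (x : Fin (k + 1) → V) : Prop :=
  Function.Injective x ∧ ∀ i : Fin k, G.Adj (x i.castSucc) (x i.succ)

/-- The free module on the strongly regular allowed elementary paths. -/
noncomputable def stronglyRegularPaths (G : Digraph V) (k : ℕ) : Submodule R (Tuples V R k) :=
  Finsupp.supported R R {x | G.IsStronglyRegularPath x}

/-- The module of `∂`-invariant strongly regular allowed paths: those chains of strongly regular
allowed paths whose boundary is again such a chain. -/
noncomputable def regularOmega (G : Digraph V) : ∀ k : ℕ, Submodule R (Tuples V R k)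
  | 0 => G.stronglyRegularPaths R 0
  | k + 1 => G.stronglyRegularPaths R (k + 1) ⊓ (G.stronglyRegularPaths R k).comap (boundary V R k)

lemma boundary_mem_regularOmega (G : Digraph V) (k : ℕ) (c : Tuples V R (k + 1))
    (hc : c ∈ G.regularOmega R (k + 1)) : boundary V R k c ∈ G.regularOmega R k := by
  cases k with
  | zero => exact hc.2
  | succ k =>
    refine ⟨hc.2, ?_⟩
    change boundary V R k (boundary V R (k + 1) c) ∈ G.stronglyRegularPaths R k
    rw [boundary_boundary]
    exact zero_mem _

/-- The chain complex whose homology is the regular path homology. -/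
noncomputable def regularPathComplex (G : Digraph V) : ChainComplex (ModuleCat.{u} R) ℕ :=
  tupleComplex (G.regularOmega R) (boundary V R) (G.boundary_mem_regularOmega R)
    (fun k c _ => boundary_boundary R k c)

/-- The regular path homology of `G`. -/
noncomputable abbrev regularPathHomology (G : Digraph V) (k : ℕ) : ModuleCat.{u} R :=
  (G.regularPathComplex R).homology k

/-- The eulerian magnitude chains: the free module on the tuples of pairwise distinct vertices of
length `l`. -/
noncomputable def eulerianChains (G : Digraph V) (l k : ℕ) : Submodule R (Tuples V R k) :=
  Finsupp.supported R R {x | Function.Injective x ∧ G.len x = l}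

open Classical in
/-- The magnitude differential in length `l`: the sum of `(-1)^i ∂_i` over the inner indices
`i = 1, …, k` of a tuple `(x_0, …, x_{k+1})`, where `∂_i` forgets the `i`-th entry if the result has
length `l` and is zero otherwise. -/
noncomputable def magnitudeBoundary (G : Digraph V) (l k : ℕ) :
    Tuples V R (k + 1) →ₗ[R] Tuples V R k :=
  Finsupp.linearCombination R fun x => ∑ i : Fin k, (-1 : R) ^ ((i : ℕ) + 1) •
    if G.len (x ∘ i.succ.castSucc.succAbove) = l
      then Finsupp.single (x ∘ i.succ.castSucc.succAbove) 1 else 0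

open Classical in
/-- The projection onto the span of the tuples of length `l`. -/
noncomputable def lenProj (G : Digraph V) (l k : ℕ) : Tuples V R k →ₗ[R] Tuples V R k :=
  Finsupp.linearCombination R fun x => if G.len x = l then Finsupp.single x 1 else 0

lemma lenProj_single (G : Digraph V) (l k : ℕ) (x : Fin (k + 1) → V) [Decidable (G.len x = l)] :
    G.lenProj R l k (Finsupp.single x 1) = if G.len x = l then Finsupp.single x 1 else 0 := by
  simp only [lenProj, Finsupp.linearCombination_single, one_smul]
  split_ifs <;> rfl

lemma len_succAbove_zero_ne (G : Digraph V) {l k : ℕ} (x : Fin (k + 2) → V)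
    (hx : Function.Injective x) (hl : G.len x = l) : G.len (x ∘ (0 : Fin (k + 2)).succAbove) ≠ l := by
  intro h
  have h1 : G.len x = G.edist (x 0) (x 1) + G.len (x ∘ (0 : Fin (k + 2)).succAbove) := by
    simp only [len]; rw [Fin.sum_univ_succ]; rfl
  rw [hl, h] at h1
  have h0 : G.edist (x 0) (x 1) ≠ 0 := edist_ne_zero (fun e => by simpa using hx e)
  generalize G.edist (x 0) (x 1) = e at *
  induction e using ENat.recTopCoe with
  | top => simp at h1
  | coe e => norm_cast at h1 h0; omega

lemma len_succAbove_last_ne (G : Digraph V) {l k : ℕ} (x : Fin (k + 2) → V)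
    (hx : Function.Injective x) (hl : G.len x = l) :
    G.len (x ∘ (Fin.last (k + 1)).succAbove) ≠ l := by
  intro h
  have h1 : G.len x = G.len (x ∘ (Fin.last (k + 1)).succAbove) +
      G.edist (x (Fin.last k).castSucc) (x (Fin.last k).succ) := by
    simp only [len]; rw [Fin.sum_univ_castSucc]; simp
  rw [hl, h] at h1
  have h0 : G.edist (x (Fin.last k).castSucc) (x (Fin.last k).succ) ≠ 0 :=
    edist_ne_zero (fun e => by simpa [Fin.ext_iff] using hx e)
  generalize G.edist (x (Fin.last k).castSucc) (x (Fin.last k).succ) = e at *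
  induction e using ENat.recTopCoe with
  | top => simp at h1
  | coe e => norm_cast at h1 h0; omega

/-- On tuples of distinct vertices of length `l`, the magnitude differential is the length `l` part
of the full boundary. -/
lemma magnitudeBoundary_eq (G : Digraph V) (l k : ℕ) (c : Tuples V R (k + 1))
    (hc : c ∈ G.eulerianChains R l (k + 1)) :
    G.magnitudeBoundary R l k c = G.lenProj R l k (boundary V R k c) := by
  classical
  rw [eulerianChains, Finsupp.supported_eq_span_single] at hc
  refine Submodule.span_induction (p := fun c _ => G.magnitudeBoundary R l k c =
    G.lenProj R l k (boundary V R k c)) ?_ ?_ ?_ ?_ hc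
  · rintro _ ⟨x, hx, rfl⟩
    rw [boundary_single, map_sum]
    simp only [map_smul, lenProj_single]
    rw [Fin.sum_univ_succ, if_neg (G.len_succAbove_zero_ne x hx.1 hx.2), smul_zero, zero_add,
      Fin.sum_univ_castSucc, Fin.succ_last, if_neg (G.len_succAbove_last_ne x hx.1 hx.2), smul_zero,
      add_zero]
    simp only [magnitudeBoundary, Finsupp.linearCombination_single, one_smul]
    refine Finset.sum_congr rfl fun i _ => ?_
    rw [Fin.succ_castSucc]
    congr 1
  · simp only [map_zero]
  · intro a b _ _ ha hb; simp only [map_add, ha, hb]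
  · intro t a _ ha; simp only [map_smul, ha]

lemma lenProj_boundary_lenProj (G : Digraph V) (l k : ℕ) (c : Tuples V R (k + 1))
    (hc : c ∈ Finsupp.supported R R {x : Fin (k + 2) → V | G.len x ≤ l}) :
    G.lenProj R l k (boundary V R k (G.lenProj R l (k + 1) c)) =
      G.lenProj R l k (boundary V R k c) := by
  classical
  rw [Finsupp.supported_eq_span_single] at hc
  refine Submodule.span_induction (p := fun c _ =>
    G.lenProj R l k (boundary V R k (G.lenProj R l (k + 1) c)) =
      G.lenProj R l k (boundary V R k c)) ?_ ?_ ?_ ?_ hc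
  · rintro _ ⟨x, hx, rfl⟩
    rw [lenProj_single]
    split_ifs with h
    · rfl
    · rw [map_zero, map_zero, boundary_single, map_sum]
      refine (Finset.sum_eq_zero fun i _ => ?_).symm
      rw [map_smul, lenProj_single, if_neg, smul_zero]
      intro h'
      have := G.len_comp_le x i.succAbove (Fin.strictMono_succAbove i).monotone
      rw [h'] at this
      exact h (le_antisymm hx this)
  · simp only [map_zero]
  · intro a b _ _ ha hb; simp only [map_add, ha, hb]
  · intro t a _ ha; simp only [map_smul, ha]

lemma magnitudeBoundary_mem (G : Digraph V) (l k : ℕ) (c : Tuples V R (k + 1))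
    (hc : c ∈ G.eulerianChains R l (k + 1)) :
    G.magnitudeBoundary R l k c ∈ G.eulerianChains R l k := by
  rw [eulerianChains, Finsupp.supported_eq_span_single] at hc
  refine Submodule.span_induction
    (p := fun c _ => G.magnitudeBoundary R l k c ∈ G.eulerianChains R l k) ?_ ?_ ?_ ?_ hc
  · rintro _ ⟨x, hx, rfl⟩
    simp only [magnitudeBoundary, Finsupp.linearCombination_single, one_smul]
    refine Submodule.sum_mem _ fun i _ => Submodule.smul_mem _ _ ?_
    split_ifs with h
    · exact Finsupp.single_mem_supported R _ ⟨hx.1.comp Fin.succAbove_right_injective, h⟩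
    · exact zero_mem _
  · rw [map_zero]; exact zero_mem _
  · intro a b _ _ ha hb; rw [map_add]; exact add_mem ha hb
  · intro t a _ ha; rw [map_smul]; exact Submodule.smul_mem _ _ ha

lemma magnitudeBoundary_magnitudeBoundary (G : Digraph V) (l k : ℕ) (c : Tuples V R (k + 2))
    (hc : c ∈ G.eulerianChains R l (k + 2)) :
    G.magnitudeBoundary R l k (G.magnitudeBoundary R l (k + 1) c) = 0 := by
  rw [G.magnitudeBoundary_eq R l k _ (G.magnitudeBoundary_mem R l (k + 1) c hc),
    G.magnitudeBoundary_eq R l (k + 1) c hc, G.lenProj_boundary_lenProj R l k, boundary_boundary,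
    map_zero]
  refine boundary_mem_supported R (P := fun k => {x : Fin (k + 1) → V | G.len x ≤ l})
    (fun k x hx i => (G.len_comp_le x i.succAbove (Fin.strictMono_succAbove i).monotone).trans hx)
    (k + 1) c ?_
  exact Finsupp.supported_mono (fun x hx => hx.2.le) hc

/-- The eulerian magnitude chain complex of `G` in length `l`. -/
noncomputable def eulerianMagnitudeComplex (G : Digraph V) (l : ℕ) :
    ChainComplex (ModuleCat.{u} R) ℕ :=
  tupleComplex (G.eulerianChains R l) (G.magnitudeBoundary R l) (G.magnitudeBoundary_mem R l)
    (G.magnitudeBoundary_magnitudeBoundary R l)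

/-- The eulerian magnitude homology `EMH_{k,l}(G)`. -/
noncomputable abbrev eulerianMagnitudeHomology (G : Digraph V) (k l : ℕ) : ModuleCat.{u} R :=
  (G.eulerianMagnitudeComplex R l).homology k

/-! ## Comparison of words with simplices, and convergence -/

/-- The simplex of the injective nerve of the reachability category given by an injective word. -/
def wordSimplex (G : Digraph V) {k : ℕ} (x : Fin (k + 1) → V) (hx : G.IsInjWord x) :
    (injectiveNerve G.Reach : SSet.{u}).obj (.op (.mk k)) :=
  let t : (nerve G.Reach).obj (.op (.mk k)) :=
    Monotone.functor (Y := G.Reach) (f := x) fun i j h => by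
      rcases h.eq_or_lt with rfl | h
      · exact Reachable.refl G _
      · exact hx.2 i j h
  ⟨t, .mk k, t, 𝟙 _, hx.1, (Functor.map_id_apply (nerve G.Reach) _ t).symm⟩

open Classical in
/-- The linear map from tuples of vertices to the normalized chains of the injective nerve which
sends an injective word to the corresponding simplex (and other tuples to zero). -/
noncomputable def wordChain (G : Digraph V) (k : ℕ) :
    Tuples V R k →ₗ[R] (G.injNerveComplex R).C.X k :=
  Finsupp.linearCombination R fun x => if hx : G.IsInjWord x then
    (SSet.ιNormalizedChainComplex (R := ModuleCat.of R R) _ (G.wordSimplex x hx)).hom (1 : R) else 0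

/-- The inclusion of the eulerian magnitude chains into the chains of all tuples. -/
noncomputable def eulerianIncl (G : Digraph V) (l k : ℕ) :
    (G.eulerianMagnitudeComplex R l).X k →ₗ[R] Tuples V R k :=
  (G.eulerianChains R l k).subtype

/-- The inclusion of the `∂`-invariant strongly regular allowed paths into the chains of all
tuples. -/
noncomputable def regularPathIncl (G : Digraph V) (k : ℕ) :
    (G.regularPathComplex R).X k →ₗ[R] Tuples V R k :=
  (G.regularOmega R k).subtype

/-- The inclusion of the chains of injective words on `G` into the chains of all tuples. -/
noncomputable def injWordsIncl (G : Digraph V) (k : ℕ) :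
    (G.injWordsComplex R).X k →ₗ[R] Tuples V R k :=
  (Finsupp.supported R R {x : Fin (k + 1) → V | G.IsInjWord x}).subtype

/-- The submodule of the homology of `Inj(G)` of all classes which are represented by a cycle
supported on injective words of length at most `p`. -/
noncomputable def injWordsHomologyFiltration (G : Digraph V) (k : ℕ) (p : ℤ) :
    Submodule R ((G.injWordsComplex R).homology k) :=
  ((Finsupp.supported R R {x : Fin (k + 1) → V | ∃ n : ℕ, G.len x ≤ n ∧ (n : ℤ) ≤ p}).comap
    ((G.injWordsIncl R k).comp ((G.injWordsComplex R).iCycles k).hom)).map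
      ((G.injWordsComplex R).homologyπ k).hom

end Digraph

/-- Convergence of a spectral sequence to graded modules `H k` with filtrations `Φ k`: each
filtration is increasing, zero in negative degrees and equal to `H k` from some degree on; and at
each position `(p, k)` the differentials vanish from some page on and the stable value
`E^∞_{p,k}` is isomorphic to `Φ_p H_k / Φ_{p-1} H_k`. The last condition says that the isomorphisms
for different pages agree under the identification of a page with the next one. -/
def ConvergesTo {R : Type u} [CommRing R]
    (E : SpectralSequence (ModuleCat.{u} R) FilteredComplex.pageShape 0)
    (H : ℕ → ModuleCat.{u} R) (Φ : ∀ k, ℤ → Submodule R (H k)) : Prop :=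
  (∀ k, Monotone (Φ k)) ∧ (∀ k, ∀ p < 0, Φ k p = ⊥) ∧ (∀ k, ∃ p, Φ k p = ⊤) ∧
  ∀ p k : ℕ, ∃ (r₀ : ℤ) (h₀ : 0 ≤ r₀),
    (∀ (r : ℤ) (hr : r₀ ≤ r) (qj : ℕ × ℕ),
      (E.page r (h₀.trans hr)).d (p, k) qj = 0 ∧ (E.page r (h₀.trans hr)).d qj (p, k) = 0) ∧
    ∃ e : ∀ (r : ℤ) (hr : r₀ ≤ r), (E.page r (h₀.trans hr)).X (p, k) ≅
        ModuleCat.of R (Φ k p ⧸ (Φ k ((p : ℤ) - 1)).comap (Φ k p).subtype),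
      ∀ (r : ℤ) (hr : r₀ ≤ r),
        (E.page r (h₀.trans hr)).iCycles (p, k) ≫ (e r hr).hom =
          (E.page r (h₀.trans hr)).homologyπ (p, k) ≫
            (E.iso r (r + 1) (p, k) rfl (h₀.trans hr)).hom ≫ (e (r + 1) (by omega)).hom

/-!
The page `E^1` of a filtered complex is the homology of its associated graded complex. A chain of
injective words of length at most `l` is determined modulo shorter words by its part of length
exactly `l`, and the outer faces strictly shorten a word, so the `l`-th graded piece of the chains
of the injective nerve is the eulerian magnitude complex.

Distinct vertices are at distance at least `1`, so `F_p C_k = 0` for `p < k`, and a word of `k + 1`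
letters has length `k` precisely when it is a path. Hence on the diagonal of the second page
`Z^2_k` is the module of cycles in `F_k C_k` and `B^2_k` is the boundary of
`{x ∈ F_{k+1} C_{k+1} | ∂x ∈ F_k C_k} = Ω_{k+1}`.

Injective words are exactly the nondegenerate simplices of the injective nerve. If the finite
distances are bounded then so is the length of a word with a given number of letters, and the
filtration is bounded in each degree, which gives convergence.
-/

namespace MagnitudePath

section ModuleHomology

variable {R : Type u} [CommRing R] {ι : Type*} {c : ComplexShape ι}
  (K : HomologicalComplex (ModuleCat.{u} R) c) (i : ι)

lemma iCycles_injective : Function.Injective (K.iCycles i) :=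
  (ModuleCat.mono_iff_injective _).1 inferInstance

lemma homologyπ_surjective : Function.Surjective (K.homologyπ i) :=
  (ModuleCat.epi_iff_surjective _).1 inferInstance

lemma d_iCycles_apply (j : ι) (z : K.cycles i) : K.d i j (K.iCycles i z) = 0 := by
  rw [← ConcreteCategory.comp_apply, K.iCycles_d]; rfl

lemma iCycles_toCycles_apply {j : ι} (y : K.X j) : K.iCycles i (K.toCycles j i y) = K.d j i y := by
  rw [← ConcreteCategory.comp_apply, K.toCycles_i]

lemma homologyπ_toCycles_apply {j : ι} (y : K.X j) : K.homologyπ i (K.toCycles j i y) = 0 := by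
  rw [← ConcreteCategory.comp_apply, K.toCycles_comp_homologyπ]; rfl

lemma homologyπ_eq_zero_iff {j : ι} (hj : c.prev i = j) (z : K.cycles i) :
    K.homologyπ i z = 0 ↔ ∃ y : K.X j, K.d j i y = K.iCycles i z := by
  have exact_toCycles := (ShortComplex.moduleCat_exact_iff _).1 <|
    ShortComplex.exact_of_g_is_cokernel
      (.mk (K.toCycles j i) (K.homologyπ i) (K.toCycles_comp_homologyπ _ _))
      (K.homologyIsCokernel j i hj)
  constructor
  · intro hz
    obtain ⟨y, rfl⟩ := exact_toCycles z hz
    exact ⟨y, (iCycles_toCycles_apply K i y).symm⟩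
  · rintro ⟨y, hy⟩
    rw [← iCycles_injective K i ((iCycles_toCycles_apply K i y).trans hy), homologyπ_toCycles_apply]

variable {K i} in
/-- A linear map with values in the cycles of `K`, as a map to `K.cycles`. -/
noncomputable def cyclesLift {M : Type u} [AddCommGroup M] [Module R M] (φ : M →ₗ[R] K.X i)
    (hφ : ∀ m j, K.d i j (φ m) = 0) : M →ₗ[R] K.cycles i :=
  (K.liftCycles (ModuleCat.ofHom φ) _ rfl (by ext m; exact hφ m _)).hom

variable {K i} in
lemma iCycles_cyclesLift {M : Type u} [AddCommGroup M] [Module R M] (φ : M →ₗ[R] K.X i)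
    (hφ : ∀ m j, K.d i j (φ m) = 0) (m : M) : K.iCycles i (cyclesLift φ hφ m) = φ m :=
  congrArg (fun f : ModuleCat.of R M ⟶ K.X i => f m) (K.liftCycles_i _ _ _ _)

end ModuleHomology

section CyclesModBoundaries

variable {R : Type u} [CommRing R] {Z : Type u} [AddCommGroup Z] [Module R Z]

lemma homologyIsoQuotient_hom_homologyπ (S : ShortComplex (ModuleCat.{u} R)) (N : Submodule R Z)
    (φ : Z →ₗ[R] S.X₂) (h₁ : ∀ z, S.g (φ z) = 0) (h₂ : ∀ x, S.g x = 0 → ∃ z y, x = φ z + S.f y)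
    (h₃ : ∀ z, z ∈ N ↔ ∃ y, S.f y = φ z) (c : S.cycles) (z : Z) (hc : S.iCycles c = φ z) :
    (ShortComplex.homologyIsoQuotient S N φ h₁ h₂ h₃).hom (S.homologyπ c) = N.mkQ z := by
  let lift := S.liftCycles (ModuleCat.ofHom φ) (by ext z; exact h₁ z)
  have c_eq : c = lift z := by
    apply (ModuleCat.mono_iff_injective S.iCycles).1 inferInstance
    rw [hc, ← ConcreteCategory.comp_apply, S.liftCycles_i]; rfl
  have inv_mkQ : (ShortComplex.homologyIsoQuotient S N φ h₁ h₂ h₃).inv (N.mkQ z) =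
      S.homologyπ (lift z) := rfl
  rw [c_eq, ← inv_mkQ, Iso.inv_hom_id_apply]

variable (K : ChainComplex (ModuleCat.{u} R) ℕ) (k : ℕ) (N : Submodule R Z) (φ : Z →ₗ[R] K.X k)
  (h₁ : ∀ z j, K.d k j (φ z) = 0) (h₂ : ∀ x, (∀ j, K.d k j x = 0) → ∃ z, φ z = x)
  (h₃ : ∀ z, z ∈ N ↔ ∃ y, K.d (k + 1) k y = φ z)

include h₂ in
lemma exists_add_d_of_d_next_eq_zero (x : K.X k)
    (hx : K.d k ((ComplexShape.down ℕ).next k) x = 0) :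
    ∃ z y, x = φ z + K.d ((ComplexShape.down ℕ).prev k) k y := by
  obtain ⟨z, rfl⟩ := h₂ x fun j => by
    by_cases hj : (ComplexShape.down ℕ).Rel k j
    · rwa [(ComplexShape.down ℕ).next_eq' hj] at hx
    · rw [K.shape _ _ hj]; rfl
  exact ⟨z, 0, by rw [map_zero, add_zero]⟩

/-- The homology of a chain complex as the quotient `Z ⧸ N`, for a linear map `φ` from `Z` onto the
cycles such that `N` consists of the elements which `φ` sends to boundaries. -/
noncomputable def homologyIsoOfCycles : K.homology k ≅ ModuleCat.of R (Z ⧸ N) :=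
  ShortComplex.homologyIsoQuotient (K.sc k) N φ (fun z => h₁ z _)
    (exists_add_d_of_d_next_eq_zero K k φ h₂) (fun z => by
      rw [h₃]
      change _ ↔ ∃ y, K.d ((ComplexShape.down ℕ).prev k) k y = φ z
      rw [ChainComplex.prev])

lemma homologyIsoOfCycles_hom_homologyπ (c : K.cycles k) (z : Z) (hc : K.iCycles k c = φ z) :
    (homologyIsoOfCycles K k N φ h₁ h₂ h₃).hom (K.homologyπ k c) = N.mkQ z :=
  homologyIsoQuotient_hom_homologyπ (K.sc k) N φ _ _ _ c z hc

end CyclesModBoundaries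

end MagnitudePath

namespace FilteredComplex

open MagnitudePath

variable {R : Type u} [CommRing R] (A : FilteredComplex R)

section Terms

variable {A} {r r' p : ℤ} {k : ℕ}

lemma Z_le_F : A.Z r p k ≤ A.F p k := fun _ hx => hx.1

lemma mem_Z_of_d_eq_zero {x : A.C.X k} (hx : x ∈ A.F p k) (hd : ∀ j, A.C.d k j x = 0) :
    x ∈ A.Z r p k :=
  ⟨hx, fun j => by rw [hd]; exact zero_mem _⟩

lemma mem_Z_zero_iff {x : A.C.X 0} : x ∈ A.Z r p 0 ↔ x ∈ A.F p 0 :=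
  ⟨fun hx => hx.1, fun hx => mem_Z_of_d_eq_zero hx fun j => by
    rw [A.C.shape _ _ (Nat.succ_ne_zero j)]; rfl⟩

lemma mem_Z_succ_iff {x : A.C.X (k + 1)} :
    x ∈ A.Z r p (k + 1) ↔ x ∈ A.F p (k + 1) ∧ A.C.d (k + 1) k x ∈ A.F (p - r) k := by
  refine ⟨fun hx => ⟨hx.1, hx.2 k⟩, fun hx => ⟨hx.1, fun j => ?_⟩⟩
  by_cases hj : j + 1 = k + 1
  · obtain rfl : j = k := Nat.succ_injective hj
    exact hx.2
  · rw [A.C.shape _ _ hj]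
    exact zero_mem _

lemma d_eq_zero_of_mem_Z (h : p < r) {x : A.C.X k} (hx : x ∈ A.Z r p k) (j : ℕ) :
    A.C.d k j x = 0 := by
  simpa only [A.neg _ _ (sub_neg.2 h), Submodule.mem_bot] using hx.2 j

lemma Z_eq_F_of_nonpos (h : r ≤ 0) : A.Z r p k = A.F p k :=
  le_antisymm Z_le_F fun _ hx => ⟨hx, fun j => A.mono (by omega) j (A.d_mem p k j _ hx)⟩

lemma mem_B_iff {x : A.C.X k} : x ∈ A.B r p k ↔
    ∃ y ∈ A.Z (r - 1) (p + r - 1) (k + 1), x - A.C.d (k + 1) k y ∈ A.Z (r - 1) (p - 1) k := by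
  refine Submodule.mem_sup.trans ⟨?_, fun ⟨y, hy, hxy⟩ => ⟨_, hxy, _, ⟨y, hy, rfl⟩, ?_⟩⟩
  · rintro ⟨a, ha, _, ⟨y, hy, rfl⟩, rfl⟩
    exact ⟨y, hy, by simpa using ha⟩
  · exact sub_add_cancel _ _

lemma mem_B_one_iff {x : A.C.X k} : x ∈ A.B 1 p k ↔
    ∃ y ∈ A.F p (k + 1), x - A.C.d (k + 1) k y ∈ A.F (p - 1) k := by
  rw [mem_B_iff, sub_self, Z_eq_F_of_nonpos le_rfl, Z_eq_F_of_nonpos le_rfl, add_sub_cancel_right]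

lemma Z_succ_le (h : r + 1 = r') : A.Z r' p k ≤ A.Z r p k :=
  A.Z_mono le_rfl (by omega) k

end Terms

section PageIso

variable {A} {r r' : ℤ} {pk : ℕ × ℕ} (hrr' : r + 1 = r') (hr : 0 ≤ r)

lemma pageIso_hom_homologyπ (c : (A.page r).cycles pk) (z : A.Z r' pk.1 pk.2)
    (hc : (A.page r).iCycles pk c =
      A.cls r pk.1 pk.2 (Submodule.inclusion (Z_succ_le hrr') z)) :
    (A.pageIso r r' pk hrr' hr).hom ((A.page r).homologyπ pk c) = A.cls r' pk.1 pk.2 z :=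
  homologyIsoQuotient_hom_homologyπ _ _ _ _ _ _ c z hc

include hr in
lemma exists_cycle_of_page_homology (x : (A.page r).homology pk) :
    ∃ (c : (A.page r).cycles pk) (z : A.Z r' pk.1 pk.2), (A.page r).homologyπ pk c = x ∧
      (A.page r).iCycles pk c = A.cls r pk.1 pk.2 (Submodule.inclusion (Z_succ_le hrr') z) := by
  obtain ⟨z, hz⟩ := Submodule.mkQ_surjective _ ((A.pageIso r r' pk hrr' hr).hom x)
  have hx := congrArg (A.pageIso r r' pk hrr' hr).inv hz
  rw [Iso.hom_inv_id_apply] at hx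
  exact ⟨_, z, hx, congrArg (fun f : ModuleCat.of R (A.Z r' pk.1 pk.2) ⟶ (A.page r).X pk => f z)
    (((A.page r).sc pk).liftCycles_i _ _)⟩

end PageIso

section Functoriality

namespace Hom

variable {A} {A' : FilteredComplex R} (φ : Hom A A')

lemma f_d_apply (i j : ℕ) (x : A.C.X i) : φ.f.f j (A.C.d i j x) = A'.C.d i j (φ.f.f i x) :=
  (ConcreteCategory.congr_hom (φ.f.comm i j) x).symm

lemma map_mem_B (r p : ℤ) (k : ℕ) {x : A.C.X k} (hx : x ∈ A.B r p k) :
    φ.f.f k x ∈ A'.B r p k := by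
  obtain ⟨y, hy, hxy⟩ := mem_B_iff.1 hx
  refine mem_B_iff.2 ⟨_, (φ.mapZ _ _ _ ⟨y, hy⟩).2, ?_⟩
  change φ.f.f k x - A'.C.d (k + 1) k (φ.f.f (k + 1) y) ∈ _
  rw [← φ.f_d_apply, ← map_sub]
  exact (φ.mapZ _ _ _ ⟨_, hxy⟩).2

/-- The map on the terms of the spectral sequences induced by a filtered chain map. -/
noncomputable def mapE (r p : ℤ) (k : ℕ) : A.E r p k →ₗ[R] A'.E r p k :=
  Submodule.mapQ _ _ (φ.mapZ r p k) fun _ hx => φ.map_mem_B r p k hx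

/-- The map on pages induced by a filtered chain map. -/
noncomputable def mapPage (r : ℤ) : A.page r ⟶ A'.page r where
  f pk := ModuleCat.ofHom (φ.mapE r pk.1 pk.2)
  comm' i j hij := by
    refine ModuleCat.hom_ext (LinearMap.ext fun x => ?_)
    obtain ⟨z, rfl⟩ := Submodule.mkQ_surjective _ x
    change (A'.page r).d i j (A'.cls r i.1 i.2 (φ.mapZ r i.1 i.2 z)) =
      φ.mapE r j.1 j.2 ((A.page r).d i j (A.cls r i.1 i.2 z))
    rw [A.page_d_apply r i j hij, A'.page_d_apply r i j hij]
    exact congrArg (A'.cls r j.1 j.2) (Subtype.ext (φ.f_d_apply _ _ _).symm)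

lemma mapPage_f_cls (r : ℤ) (pk : ℕ × ℕ) (z : A.Z r pk.1 pk.2) :
    (φ.mapPage r).f pk (A.cls r pk.1 pk.2 z) = A'.cls r pk.1 pk.2 (φ.mapZ r pk.1 pk.2 z) := rfl

/-- The morphism of spectral sequences induced by a filtered chain map. -/
noncomputable def mapSpectralSequence : A.spectralSequence ⟶ A'.spectralSequence :=
  SpectralSequence.Hom.mk (fun r _ => φ.mapPage r) fun r r' pk hrr' hr => by
    refine ModuleCat.hom_ext (LinearMap.ext fun x => ?_)
    change (A'.pageIso r r' pk hrr' hr).hom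
        (HomologicalComplex.homologyMap (φ.mapPage r) pk x) =
      (φ.mapPage r').f pk ((A.pageIso r r' pk hrr' hr).hom x)
    obtain ⟨c, z, rfl, hc⟩ := exists_cycle_of_page_homology hrr' hr x
    have homologyMap_π := ConcreteCategory.congr_hom
      (HomologicalComplex.homologyπ_naturality (φ.mapPage r) pk) c
    have cyclesMap_i := ConcreteCategory.congr_hom
      (HomologicalComplex.cyclesMap_i (φ.mapPage r) pk) c
    simp only [ConcreteCategory.comp_apply] at homologyMap_π cyclesMap_i
    rw [pageIso_hom_homologyπ hrr' hr c z hc, mapPage_f_cls, homologyMap_π]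
    refine pageIso_hom_homologyπ hrr' hr _ _ ?_
    rw [cyclesMap_i, hc, mapPage_f_cls]
    rfl

end Hom

end Functoriality

section FirstPage

/-- A chain complex `K` with an isomorphism to the graded piece `F_p / F_{p-1}` of a filtered
complex, given as surjections `F_p → K` with kernel `F_{p-1}` which commute with the
differentials. -/
structure GradedPiece (p : ℤ) (K : ChainComplex (ModuleCat.{u} R) ℕ) where
  proj (k : ℕ) : A.F p k →ₗ[R] K.X k
  proj_surjective (k : ℕ) : Function.Surjective (proj k)
  proj_eq_zero_iff {k : ℕ} (x : A.F p k) : proj k x = 0 ↔ x.1 ∈ A.F (p - 1) k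
  d_proj (i j : ℕ) (x : A.F p i) :
    K.d i j (proj i x) = proj j ⟨A.C.d i j x.1, A.d_mem p i j x.1 x.2⟩

namespace GradedPiece

variable {A} {p : ℤ} {K : ChainComplex (ModuleCat.{u} R) ℕ} (P : A.GradedPiece p K) (k : ℕ)

/-- The restriction of the projection `F_p → K` to `Z^1_p`. -/
noncomputable def projZ : A.Z 1 p k →ₗ[R] K.X k := P.proj k ∘ₗ Submodule.inclusion Z_le_F

lemma mem_Z_one_iff (x : A.F p k) : x.1 ∈ A.Z 1 p k ↔ ∀ j, K.d k j (P.proj k x) = 0 := by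
  simp only [P.d_proj, P.proj_eq_zero_iff]
  exact and_iff_right x.2

lemma d_projZ (z : A.Z 1 p k) (j : ℕ) : K.d k j (P.projZ k z) = 0 :=
  (P.mem_Z_one_iff k ⟨z.1, z.2.1⟩).1 z.2 j

lemma exists_projZ_eq (x : K.X k) (hx : ∀ j, K.d k j x = 0) : ∃ z, P.projZ k z = x := by
  obtain ⟨y, rfl⟩ := P.proj_surjective k x
  exact ⟨⟨y.1, (P.mem_Z_one_iff k y).2 hx⟩, rfl⟩

lemma mem_B_one_iff_exists_d_eq_projZ (z : A.Z 1 p k) :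
    z.1 ∈ A.B 1 p k ↔ ∃ y, K.d (k + 1) k y = P.projZ k z := by
  have sub_d_mem_iff (y : A.F p (k + 1)) : z.1 - A.C.d (k + 1) k y.1 ∈ A.F (p - 1) k ↔
      K.d (k + 1) k (P.proj (k + 1) y) = P.projZ k z := by
    rw [P.d_proj, eq_comm, ← sub_eq_zero, projZ, LinearMap.comp_apply, ← map_sub,
      P.proj_eq_zero_iff]
    rfl
  rw [mem_B_one_iff]
  constructor
  · rintro ⟨y, hy, hzy⟩
    exact ⟨_, (sub_d_mem_iff ⟨y, hy⟩).1 hzy⟩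
  · rintro ⟨y, hzy⟩
    obtain ⟨y, rfl⟩ := P.proj_surjective (k + 1) y
    exact ⟨y.1, y.2, (sub_d_mem_iff y).2 hzy⟩

/-- The first page of the spectral sequence is the homology of the associated graded complex. -/
noncomputable def homologyIso : K.homology k ≅ ModuleCat.of R (A.E 1 p k) :=
  homologyIsoOfCycles K k _ (P.projZ k) (P.d_projZ k) (P.exists_projZ_eq k)
    (P.mem_B_one_iff_exists_d_eq_projZ k)

lemma homologyIso_hom_homologyπ (c : K.cycles k) (z : A.Z 1 p k)
    (hc : K.iCycles k c = P.projZ k z) :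
    (P.homologyIso k).hom (K.homologyπ k c) = A.cls 1 p k z :=
  homologyIsoOfCycles_hom_homologyπ K k _ _ _ _ _ c z hc

end GradedPiece

end FirstPage

section Diagonal

variable {A} (hF : ∀ (p : ℤ) (k : ℕ), p < k → A.F p k = ⊥)

include hF in
lemma d_eq_zero_of_mem_Z_two {k : ℕ} {x : A.C.X k} (hx : x ∈ A.Z 2 k k) (j : ℕ) :
    A.C.d k j x = 0 := by
  by_cases hj : j + 1 = k
  · simpa only [hF ((k : ℤ) - 2) j (by omega), Submodule.mem_bot] using hx.2 j
  · rw [A.C.shape _ _ hj]; rfl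

include hF in
lemma mem_B_two_iff {k : ℕ} {x : A.C.X k} :
    x ∈ A.B 2 k k ↔ ∃ y ∈ A.Z 1 (k + 1 : ℕ) (k + 1), A.C.d (k + 1) k y = x := by
  have Z_eq_bot : A.Z 1 ((k : ℤ) - 1) k = ⊥ :=
    le_bot_iff.1 (Z_le_F.trans (hF _ k (by omega)).le)
  rw [mem_B_iff, show (2 : ℤ) - 1 = 1 by rfl, Z_eq_bot,
    show (k : ℤ) + 2 - 1 = (k + 1 : ℕ) by push_cast; ring]
  exact exists_congr fun y => and_congr_right fun _ => sub_eq_zero.trans eq_comm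

variable {K : ChainComplex (ModuleCat.{u} R) ℕ} (ρ : ∀ k : ℕ, K.X k ≃ₗ[R] A.Z 1 k k)
  (hρ : ∀ (k : ℕ) (x : K.X (k + 1)),
    (ρ k (K.d (k + 1) k x)).1 = A.C.d (k + 1) k (ρ (k + 1) x).1) (k : ℕ)

include hρ in
lemma d_diagonal_eq_zero_iff (x : K.X k) :
    (∀ j, A.C.d k j (ρ k x).1 = 0) ↔ ∀ j, K.d k j x = 0 := by
  refine forall_congr' fun j => ?_
  by_cases hj : j + 1 = k
  · subst hj
    rw [← hρ, ZeroMemClass.coe_eq_zero, LinearEquiv.map_eq_zero_iff]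
  · rw [K.shape _ _ hj, A.C.shape _ _ hj]
    exact iff_of_true rfl rfl

include hF hρ in
lemma mem_B_two_iff_exists_d_eq (x : K.X k) :
    (ρ k x).1 ∈ A.B 2 k k ↔ ∃ y, K.d (k + 1) k y = x := by
  rw [mem_B_two_iff hF]
  constructor
  · rintro ⟨y, hy, hyx⟩
    obtain ⟨y, rfl⟩ : ∃ y', (ρ (k + 1) y').1 = y := ⟨(ρ (k + 1)).symm ⟨y, hy⟩, by simp⟩
    exact ⟨y, (ρ k).injective (Subtype.ext ((hρ k y).trans hyx))⟩
  · rintro ⟨y, rfl⟩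
    exact ⟨_, (ρ (k + 1) y).2, (hρ k y).symm⟩

/-- If `F_p C_k` vanishes for `p < k`, then the diagonal of the second page is the homology of the
complex of the modules `Z^1_{k,k}`. -/
noncomputable def diagonalIso : K.homology k ≅ ModuleCat.of R (A.E 2 k k) :=
  homologyIsoOfCycles K k _
    ((ρ k).symm.toLinearMap ∘ₗ Submodule.inclusion (Z_succ_le one_add_one_eq_two))
    (fun z => (d_diagonal_eq_zero_iff ρ hρ k _).1 <| by
      simpa using d_eq_zero_of_mem_Z_two hF z.2)
    (fun x hx => ⟨⟨(ρ k x).1,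
      mem_Z_of_d_eq_zero (ρ k x).2.1 ((d_diagonal_eq_zero_iff ρ hρ k x).2 hx)⟩,
        (ρ k).symm_apply_apply x⟩)
    (fun z => by
      rw [Submodule.mem_comap, ← mem_B_two_iff_exists_d_eq hF ρ hρ k]
      simp)

lemma diagonalIso_hom_homologyπ (c : K.cycles k) (z : A.Z 2 k k)
    (hz : z.1 = (ρ k (K.iCycles k c)).1) :
    (diagonalIso hF ρ hρ k).hom (K.homologyπ k c) = A.cls 2 k k z :=
  homologyIsoOfCycles_hom_homologyπ K k _ _ _ _ _ c z <|
    (ρ k).injective <| Subtype.ext <| by simpa using hz.symm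

end Diagonal

section Convergence

/-- The filtration of the homology of a filtered complex by the classes of the cycles in `F_p`. -/
noncomputable def homologyFiltration (k : ℕ) (p : ℤ) : Submodule R (A.C.homology k) :=
  ((A.F p k).comap (A.C.iCycles k).hom).map (A.C.homologyπ k).hom

variable {A} {r p : ℤ} {k : ℕ}

lemma homologyπ_mem_homologyFiltration_iff (c : A.C.cycles k) :
    A.C.homologyπ k c ∈ A.homologyFiltration k p ↔
      ∃ y : A.C.X (k + 1), A.C.iCycles k c - A.C.d (k + 1) k y ∈ A.F p k := by
  constructor
  · rintro ⟨c', hc', h⟩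
    obtain ⟨y, hy⟩ := (homologyπ_eq_zero_iff A.C k (ChainComplex.prev ℕ k) (c - c')).1
      (by rw [map_sub, sub_eq_zero]; exact h.symm)
    exact ⟨y, by rwa [hy, map_sub, sub_sub_cancel]⟩
  · rintro ⟨y, hy⟩
    refine ⟨c - A.C.toCycles (k + 1) k y, ?_, ?_⟩
    · change A.C.iCycles k (c - A.C.toCycles (k + 1) k y) ∈ A.F p k
      rwa [map_sub, iCycles_toCycles_apply]
    · rw [map_sub, homologyπ_toCycles_apply, sub_zero]

lemma mem_B_iff_of_lt (h : p < r) (htop : A.F (p + r - 1) (k + 1) = ⊤) {x : A.C.X k}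
    (hx : x ∈ A.Z r p k) : x ∈ A.B r p k ↔ ∃ y, x - A.C.d (k + 1) k y ∈ A.F (p - 1) k := by
  rw [mem_B_iff]
  refine ⟨fun ⟨y, _, hxy⟩ => ⟨y, hxy.1⟩, fun ⟨y, hxy⟩ => ⟨y, ⟨htop ▸ trivial, fun j => ?_⟩,
    mem_Z_of_d_eq_zero hxy fun j => by
      rw [map_sub, A.d_d, d_eq_zero_of_mem_Z h hx, sub_zero]⟩⟩
  by_cases hj : j + 1 = k + 1
  · obtain rfl : j = k := by omega
    rw [← sub_sub_cancel x (A.C.d (j + 1) j y), show p + r - 1 - (r - 1) = p by omega]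
    exact sub_mem hx.1 (A.mono (by omega) _ hxy)
  · rw [A.C.shape _ _ hj]
    exact zero_mem _

/-- For `p < r` the elements of `Z^r_p` are cycles. -/
noncomputable def cyclesOfZ (h : p < r) : A.Z r p k →ₗ[R] A.C.cycles k :=
  cyclesLift (A.Z r p k).subtype fun z => d_eq_zero_of_mem_Z h z.2

lemma iCycles_cyclesOfZ (h : p < r) (z : A.Z r p k) : A.C.iCycles k (cyclesOfZ h z) = z.1 :=
  iCycles_cyclesLift _ _ z

/-- For `p < r`, the map sending an element of `Z^r_p` to its homology class modulo the classes of
cycles in `F_{p-1}`. -/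
noncomputable def toGradedHomology (h : p < r) : A.Z r p k →ₗ[R]
    A.homologyFiltration k p ⧸
      (A.homologyFiltration k (p - 1)).comap (A.homologyFiltration k p).subtype :=
  Submodule.mkQ _ ∘ₗ ((A.C.homologyπ k).hom ∘ₗ cyclesOfZ h).codRestrict _ fun z =>
    ⟨cyclesOfZ h z, (congrArg (· ∈ A.F p k) (iCycles_cyclesOfZ h z)).mpr z.2.1, rfl⟩

lemma toGradedHomology_surjective (h : p < r) :
    Function.Surjective (toGradedHomology (A := A) (k := k) h) := by
  refine (Submodule.mkQ_surjective _).comp ?_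
  rintro ⟨_, c, hc, rfl⟩
  let z : A.Z r p k := ⟨A.C.iCycles k c, mem_Z_of_d_eq_zero hc fun j => d_iCycles_apply A.C k j c⟩
  exact ⟨z, Subtype.ext (congrArg (A.C.homologyπ k)
    (iCycles_injective A.C k (iCycles_cyclesOfZ h z)))⟩

lemma toGradedHomology_eq_zero_iff (h : p < r) (htop : A.F (p + r - 1) (k + 1) = ⊤)
    (z : A.Z r p k) : toGradedHomology h z = 0 ↔ z.1 ∈ A.B r p k := by
  have eq_zero_iff : toGradedHomology h z = 0 ↔
      A.C.homologyπ k (cyclesOfZ h z) ∈ A.homologyFiltration k (p - 1) :=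
    Submodule.Quotient.mk_eq_zero _
  rw [eq_zero_iff, homologyπ_mem_homologyFiltration_iff, iCycles_cyclesOfZ,
    mem_B_iff_of_lt h htop z.2]

/-- For large `r` the term `E^r_{p,k}` is the graded piece of the homology filtration. -/
noncomputable def gradedHomologyIso (h : p < r) (htop : A.F (p + r - 1) (k + 1) = ⊤) :
    ModuleCat.of R (A.E r p k) ≅ ModuleCat.of R (A.homologyFiltration k p ⧸
      (A.homologyFiltration k (p - 1)).comap (A.homologyFiltration k p).subtype) :=
  ((Submodule.quotEquivOfEq _ _
      (Submodule.ext fun z => (toGradedHomology_eq_zero_iff h htop z).symm)).trans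
    ((toGradedHomology h).quotKerEquivOfSurjective (toGradedHomology_surjective h))).toModuleIso

lemma gradedHomologyIso_hom_cls (h : p < r) (htop : A.F (p + r - 1) (k + 1) = ⊤)
    (z : A.Z r p k) : (gradedHomologyIso h htop).hom (A.cls r p k z) = toGradedHomology h z := rfl

lemma page_d_from_eq_zero {p k : ℕ} (h : (p : ℤ) < r) (qj : ℕ × ℕ) :
    (A.page r).d (p, k) qj = 0 :=
  (A.page r).shape _ _ fun hrel => by
    have := hrel.1
    simp only at this
    omega

lemma page_d_to_eq_zero {p k : ℕ} (htop : A.F (p + r - 1) (k + 1) = ⊤) (qj : ℕ × ℕ) :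
    (A.page r).d qj (p, k) = 0 := by
  by_cases hrel : (pageShape r).Rel qj (p, k)
  · obtain ⟨q, j⟩ := qj
    refine ModuleCat.hom_ext (LinearMap.ext fun x => ?_)
    obtain ⟨z, rfl⟩ := Submodule.mkQ_surjective _ x
    refine (A.page_d_apply r _ _ hrel z).trans ((Submodule.Quotient.mk_eq_zero _).2 ?_)
    obtain ⟨hq, hj⟩ := hrel
    simp only at hq hj
    obtain rfl : j = k + 1 := by omega
    refine Submodule.mem_sup_right ⟨z.1, ⟨htop ▸ trivial, fun l => ?_⟩, rfl⟩
    simpa only [show (q : ℤ) - r = p + r - 1 - (r - 1) by omega] using z.2.2 l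
  · exact (A.page r).shape _ _ hrel

lemma homologyFiltration_mono : Monotone (A.homologyFiltration k) :=
  fun _ _ h => Submodule.map_mono (Submodule.comap_mono (A.mono h k))

lemma homologyFiltration_eq_bot (h : p < 0) : A.homologyFiltration k p = ⊥ := by
  have ker_iCycles : LinearMap.ker (A.C.iCycles k).hom = ⊥ :=
    LinearMap.ker_eq_bot.2 (iCycles_injective A.C k)
  rw [homologyFiltration, A.neg p k h, ← LinearMap.ker, ker_iCycles, Submodule.map_bot]

lemma homologyFiltration_eq_top (h : A.F p k = ⊤) : A.homologyFiltration k p = ⊤ := by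
  rw [homologyFiltration, h, Submodule.comap_top, Submodule.map_top]
  exact LinearMap.range_eq_top.2 (homologyπ_surjective A.C k)

lemma iCycles_comp_gradedHomologyIso_hom {p : ℕ} (hr : 0 ≤ r) (h : (p : ℤ) < r)
    (htop : A.F (p + r - 1) (k + 1) = ⊤) (htop' : A.F (p + (r + 1) - 1) (k + 1) = ⊤) :
    (A.page r).iCycles (p, k) ≫ (gradedHomologyIso h htop).hom =
      (A.page r).homologyπ (p, k) ≫ (A.pageIso r (r + 1) (p, k) rfl hr).hom ≫
        (gradedHomologyIso (h.trans (lt_add_one r)) htop').hom := by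
  refine ModuleCat.hom_ext (LinearMap.ext fun c => ?_)
  obtain ⟨z, hz⟩ := Submodule.mkQ_surjective _ ((A.page r).iCycles (p, k) c)
  let z' : A.Z (r + 1) p k := ⟨z.1, mem_Z_of_d_eq_zero z.2.1 (d_eq_zero_of_mem_Z h z.2)⟩
  change (gradedHomologyIso h htop).hom ((A.page r).iCycles (p, k) c) =
    (gradedHomologyIso _ htop').hom
      ((A.pageIso r (r + 1) (p, k) rfl hr).hom ((A.page r).homologyπ (p, k) c))
  rw [pageIso_hom_homologyπ rfl hr c z' hz.symm, gradedHomologyIso_hom_cls, ← hz]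
  exact congrArg (Submodule.mkQ _) (Subtype.ext (congrArg (A.C.homologyπ k)
    (iCycles_injective A.C k ((iCycles_cyclesOfZ h z).trans (iCycles_cyclesOfZ _ z').symm))))

theorem convergesTo (hF : ∀ k, ∃ p, A.F p k = ⊤) :
    ConvergesTo A.spectralSequence (fun k => A.C.homology k) A.homologyFiltration := by
  refine ⟨fun _ => homologyFiltration_mono, fun _ _ => homologyFiltration_eq_bot,
    fun k => (hF k).imp fun _ => homologyFiltration_eq_top, fun p k => ?_⟩
  obtain ⟨q, hq⟩ := hF (k + 1)
  have F_eq_top (r : ℤ) (hr : max (p + 1 : ℤ) (q + 1) ≤ r) : A.F (p + r - 1) (k + 1) = ⊤ :=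
    top_le_iff.1 (hq ▸ A.mono (by omega) (k + 1))
  refine ⟨max (p + 1) (q + 1), by omega,
    fun r hr qj => ⟨page_d_from_eq_zero (by omega) qj, page_d_to_eq_zero (F_eq_top r hr) qj⟩,
    fun r hr => gradedHomologyIso (by omega) (F_eq_top r hr), fun r hr => ?_⟩
  exact iCycles_comp_gradedHomologyIso_hom (by omega) (by omega) (F_eq_top r hr)
    (F_eq_top _ (by omega))

end Convergence

end FilteredComplex

namespace MagnitudePath

lemma map_submoduleMap_comap_subtype {R M N : Type*} [Ring R] [AddCommGroup M] [Module R M]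
    [AddCommGroup N] [Module R N] (e : M ≃ₗ[R] N) (P Q : Submodule R M) :
    (Q.comap P.subtype).map (e.submoduleMap P).toLinearMap =
      (Q.map e.toLinearMap).comap (P.map e.toLinearMap).subtype := by
  ext ⟨_, x, hx, rfl⟩
  constructor
  · rintro ⟨x', hx', h⟩
    exact ⟨x', hx', congrArg Subtype.val h⟩
  · rintro ⟨x', hx', h⟩
    obtain rfl := e.injective h
    exact ⟨⟨x', hx⟩, hx', rfl⟩

end MagnitudePath

namespace ConvergesTo

open MagnitudePath

variable {R : Type u} [CommRing R]
  {E : SpectralSequence (ModuleCat.{u} R) FilteredComplex.pageShape 0}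
  {H H' : ℕ → ModuleCat.{u} R} {Φ : ∀ k, ℤ → Submodule R (H k)} {Φ' : ∀ k, ℤ → Submodule R (H' k)}

theorem of_iso (h : ConvergesTo E H Φ) (e : ∀ k, H k ≅ H' k)
    (hΦ : ∀ k p, (Φ k p).map (e k).hom.hom = Φ' k p) : ConvergesTo E H' Φ' := by
  obtain ⟨hmono, hneg, htop, hstable⟩ := h
  obtain rfl : (fun k p => (Φ k p).map (e k).hom.hom) = Φ' := funext₂ hΦ
  refine ⟨fun k p q hpq => Submodule.map_mono (hmono k hpq),
    fun k p hp => by simp only [hneg k p hp, Submodule.map_bot],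
    fun k => (htop k).imp fun p hp => ?_, fun p k => ?_⟩
  · simp only [hp, Submodule.map_top]
    exact LinearMap.range_eq_top.2 (e k).toLinearEquiv.surjective
  · obtain ⟨r₀, h₀, hd, f, hf⟩ := hstable p k
    let g : ModuleCat.of R (Φ k p ⧸ (Φ k ((p : ℤ) - 1)).comap (Φ k p).subtype) ≅
        ModuleCat.of R ((Φ k p).map (e k).hom.hom ⧸
          ((Φ k ((p : ℤ) - 1)).map (e k).hom.hom).comap ((Φ k p).map (e k).hom.hom).subtype) :=
      (Submodule.Quotient.equiv _ _ ((e k).toLinearEquiv.submoduleMap (Φ k p))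
        (map_submoduleMap_comap_subtype _ _ _)).toModuleIso
    refine ⟨r₀, h₀, hd, fun r hr => f r hr ≪≫ g, fun r hr => ?_⟩
    simp only [Iso.trans_hom, ← Category.assoc]
    rw [hf r hr]
    simp only [Category.assoc]

end ConvergesTo

namespace MagnitudePath

section NormalizedChains

variable (R : Type u) [CommRing R] (X : SSet.{u}) {n : ℕ}

/-- The normalized chain with coefficients in `R` given by a simplex; it is zero for a degenerate
simplex. -/
noncomputable def simplexChain (s : X.obj (.op (.mk n))) :
    (X.normalizedChainComplex (ModuleCat.of R R)).X n :=
  (X.ιNormalizedChainComplex (R := ModuleCat.of R R) s).hom (1 : R)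

lemma simplexChain_eq_zero {s : X.obj (.op (.mk n))} (hs : s ∈ X.degenerate n) :
    simplexChain R X s = 0 := by
  rw [simplexChain, X.ιNormalizedChainComplex_eq_zero s hs]
  rfl

lemma d_simplexChain (s : X.obj (.op (.mk (n + 1)))) :
    (X.normalizedChainComplex (ModuleCat.of R R)).d (n + 1) n (simplexChain R X s) =
      ∑ i : Fin (n + 2), (-1 : R) ^ (i : ℕ) • simplexChain R X (X.δ i s) := by
  refine (congrArg (fun f : ModuleCat.of R R ⟶ (X.normalizedChainComplex _).X n => f.hom (1 : R))
    (X.ιNormalizedChainComplex_d (R := ModuleCat.of R R) s)).trans ?_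
  simp only [ModuleCat.hom_sum, LinearMap.sum_apply]
  refine Finset.sum_congr rfl fun i _ => ?_
  rw [← Int.cast_smul_eq_zsmul R]
  push_cast
  rfl

lemma normalizedChainComplexMap_f_simplexChain {X Y : SSet.{u}} (f : X ⟶ Y)
    (s : X.obj (.op (.mk n))) :
    (SSet.normalizedChainComplexMap f (ModuleCat.of R R)).f n (simplexChain R X s) =
      simplexChain R Y (f.app _ s) :=
  congrArg (fun g : ModuleCat.of R R ⟶ (Y.normalizedChainComplex _).X n => g.hom (1 : R))
    (SSet.ι_normalizedChainComplexMap_f (R := ModuleCat.of R R) f s)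

variable (n) in
/-- The basis of the normalized `n`-chains given by the nondegenerate simplices. -/
noncomputable def nonDegenerateBasis :
    Module.Basis (X.nonDegenerate n) R ((X.normalizedChainComplex (ModuleCat.of R R)).X n) :=
  let singles := Limits.Cofan.mk (ModuleCat.of R (X.nonDegenerate n →₀ R))
    fun s : X.nonDegenerate n => ModuleCat.ofHom (Finsupp.lsingle (R := R) (M := R) s)
  let repr := (X.isColimitCofanNormalizedChainComplex (ModuleCat.of R R) n).desc singles
  have repr_simplexChain (s : X.nonDegenerate n) :
      repr (simplexChain R X s) = Finsupp.single s (1 : R) :=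
    congrArg (fun f : ModuleCat.of R R ⟶ ModuleCat.of R (X.nonDegenerate n →₀ R) => f.hom (1 : R))
      ((X.isColimitCofanNormalizedChainComplex (ModuleCat.of R R) n).fac singles ⟨s⟩)
  .ofRepr <| .ofLinearMap repr.hom (Finsupp.linearCombination R fun s => simplexChain R X s.1)
    (Finsupp.lhom_ext' fun s => LinearMap.ext_ring <| by
      simpa using! repr_simplexChain s)
    (congrArg ModuleCat.Hom.hom <| SSet.normalizedChainComplex_hom_ext X
      (f := repr ≫ ModuleCat.ofHom (Finsupp.linearCombination R fun s => simplexChain R X s.1))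
      (g := 𝟙 _) fun s hs => ModuleCat.hom_ext <| LinearMap.ext_ring <| by
        refine (congrArg (Finsupp.linearCombination R _) (repr_simplexChain ⟨s, hs⟩)).trans ?_
        rw [Finsupp.linearCombination_single, one_smul]
        rfl)

lemma nonDegenerateBasis_apply (s : X.nonDegenerate n) :
    nonDegenerateBasis R X n s = simplexChain R X s.1 := by
  change Finsupp.linearCombination R (fun s : X.nonDegenerate n => simplexChain R X s.1) _ = _
  rw [Finsupp.linearCombination_single, one_smul]

lemma span_range_simplexChain :
    Submodule.span R (Set.range (simplexChain R X (n := n))) = ⊤ := by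
  rw [← top_le_iff, ← (nonDegenerateBasis R X n).span_eq]
  refine Submodule.span_mono ?_
  rintro _ ⟨s, rfl⟩
  exact ⟨s, (nonDegenerateBasis_apply R X s).symm⟩

lemma mem_range_normalizedChainComplexMap_ι_iff (A : X.Subcomplex)
    (c : (X.normalizedChainComplex (ModuleCat.of R R)).X n) :
    c ∈ LinearMap.range ((SSet.normalizedChainComplexMap A.ι (ModuleCat.of R R)).f n).hom ↔
      ∀ s ∈ ((nonDegenerateBasis R X n).repr c).support, s.1 ∈ A.obj (.op (.mk n)) := by
  have range_eq :
      LinearMap.range ((SSet.normalizedChainComplexMap A.ι (ModuleCat.of R R)).f n).hom =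
        Submodule.span R (nonDegenerateBasis R X n '' {s | s.1 ∈ A.obj (.op (.mk n))}) := by
    rw [LinearMap.range_eq_map, ← span_range_simplexChain, Submodule.map_span, ← Set.range_comp]
    refine le_antisymm (Submodule.span_le.2 ?_) (Submodule.span_mono ?_)
    · rintro _ ⟨s, rfl⟩
      refine (congrArg (· ∈ _) (normalizedChainComplexMap_f_simplexChain R A.ι s)).mpr ?_
      by_cases hs : s.1 ∈ X.nonDegenerate n
      · exact Submodule.subset_span ⟨⟨s.1, hs⟩, s.2, nonDegenerateBasis_apply R X _⟩
      · rw [SSet.mem_nonDegenerate_iff_notMem_degenerate, not_not] at hs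
        exact (simplexChain_eq_zero R X hs).symm ▸ zero_mem _
    · rintro _ ⟨s, hs, rfl⟩
      exact ⟨⟨s.1, hs⟩, (normalizedChainComplexMap_f_simplexChain R A.ι _).trans
        (nonDegenerateBasis_apply R X s).symm⟩
  rw [range_eq, Module.Basis.mem_span_image]
  rfl

end NormalizedChains

open Digraph

lemma eqOn_supported {α R M : Type*} [Semiring R] [AddCommMonoid M] [Module R M] {s : Set α}
    {f g : (α →₀ R) →ₗ[R] M}
    (h : ∀ x ∈ s, f (Finsupp.single x 1) = g (Finsupp.single x 1)) :
    Set.EqOn f g (Finsupp.supported R R s) := by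
  rw [Finsupp.supported_eq_span_single]
  exact LinearMap.eqOn_span (Set.forall_mem_image.2 h)

section InjectiveWords

lemma mem_nonDegenerate_injectiveNerve_iff {C : Type u} [Category.{u} C] {n : ℕ}
    (s : (injectiveNerve C : SSet.{u}).obj (.op (.mk n))) :
    s ∈ (injectiveNerve C : SSet.{u}).nonDegenerate n ↔ Function.Injective s.1.obj := by
  rw [SSet.mem_nonDegenerate_iff_notMem_degenerate, ← not_iff_not, not_not]
  constructor
  · intro hs hinj
    cases n with
    | zero => simp at hs
    | succ n =>
      simp only [SSet.degenerate_eq_iUnion_range_σ, Set.mem_iUnion, Set.mem_range] at hs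
      obtain ⟨i, y, rfl⟩ := hs
      have h : y.1.obj (i.predAbove i.castSucc) = y.1.obj (i.predAbove i.succ) := by simp
      exact Fin.castSucc_lt_succ.ne (hinj h)
  · intro hs
    obtain ⟨s, m, t, σ, ht, rfl⟩ := s
    cases n with
    | zero => exact (hs fun a b _ => Subsingleton.elim (α := Fin 1) a b).elim
    | succ n =>
      have hσ : ¬ Function.Injective σ.toOrderHom := fun hσ => hs (ht.comp hσ)
      obtain ⟨i, σ', rfl⟩ := SimplexCategory.eq_σ_comp_of_not_injective σ hσ
      rw [SSet.degenerate_eq_iUnion_range_σ]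
      refine Set.mem_iUnion.2 ⟨i, ⟨(nerve C).map σ'.op t, m, t, σ', ht, rfl⟩, Subtype.ext ?_⟩
      exact (Functor.map_comp_apply (nerve C) σ'.op (SimplexCategory.σ i).op t).symm

variable {V : Type u} (G : Digraph V) {k : ℕ}

lemma isInjWord_of_injective (s : (nerve G.Reach).obj (.op (.mk k)))
    (hs : Function.Injective s.obj) : G.IsInjWord (V := V) s.obj :=
  ⟨hs, fun _ _ h => leOfHom (s.map (homOfLE h.le))⟩

variable {G} in
lemma isInjWord_comp_succAbove {x : Fin (k + 2) → V} (hx : G.IsInjWord x) (i : Fin (k + 2)) :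
    G.IsInjWord (x ∘ i.succAbove) :=
  ⟨hx.1.comp Fin.succAbove_right_injective,
    fun _ _ h => hx.2 _ _ (Fin.strictMono_succAbove i h)⟩

variable (k) in
/-- Injective words on `G` are the nondegenerate simplices of the injective nerve of the
reachability category. -/
def injWordEquivNonDegenerate :
    {x : Fin (k + 1) → V // G.IsInjWord x} ≃
      (injectiveNerve G.Reach : SSet.{u}).nonDegenerate k where
  toFun x := ⟨G.wordSimplex x.1 x.2, (mem_nonDegenerate_injectiveNerve_iff _).2 x.2.1⟩
  invFun s := ⟨s.1.1.obj,
    isInjWord_of_injective G s.1.1 ((mem_nonDegenerate_injectiveNerve_iff s.1).1 s.2)⟩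
  right_inv _ := Subtype.ext <| Subtype.ext <|
    CategoryTheory.Functor.ext (fun _ => rfl) fun _ _ _ => Subsingleton.elim _ _

variable (R : Type u) [CommRing R]

variable (k) in
/-- The chains of injective words on `G`. -/
abbrev injWordChains : Submodule R (Tuples V R k) :=
  Finsupp.supported R R {x | G.IsInjWord x}

lemma wordChain_single {x : Fin (k + 1) → V} (hx : G.IsInjWord x) :
    G.wordChain R k (Finsupp.single x 1) = simplexChain R _ (G.wordSimplex x hx) := by
  classical
  rw [wordChain, Finsupp.linearCombination_single, one_smul]
  exact dif_pos hx

variable (k) in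
/-- The isomorphism between the chains of injective words and the normalized chains of the
injective nerve. -/
noncomputable def injWordChainsEquiv :
    injWordChains G k R ≃ₗ[R] (G.injNerveComplex R).C.X k :=
  Finsupp.supportedEquivFinsupp _ ≪≫ₗ
    ((nonDegenerateBasis R _ k).reindex (injWordEquivNonDegenerate G k).symm).repr.symm

lemma injWordChainsEquiv_apply (c : injWordChains G k R) :
    injWordChainsEquiv G k R c = G.wordChain R k c := by
  let e := Finsupp.supportedEquivFinsupp (R := R) (M := R) {x : Fin (k + 1) → V | G.IsInjWord x}
  suffices h : (injWordChainsEquiv G k R).toLinearMap =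
    (G.wordChain R k).comp (injWordChains G k R).subtype from LinearMap.congr_fun h c
  rw [← LinearMap.cancel_right e.symm.surjective]
  refine Finsupp.lhom_ext' fun x => LinearMap.ext_ring ?_
  change ((nonDegenerateBasis R _ k).reindex _).repr.symm (e (e.symm (Finsupp.single x 1))) =
    G.wordChain R k (e.symm (Finsupp.single x 1))
  rw [LinearEquiv.apply_symm_apply, Finsupp.supportedEquivFinsupp_symm_single,
    wordChain_single G R x.2, Module.Basis.repr_symm_single_one, Module.Basis.reindex_apply,
    nonDegenerateBasis_apply]
  rfl

lemma nonDegenerateBasis_repr_wordChain (c : injWordChains G k R)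
    (x : {x : Fin (k + 1) → V // G.IsInjWord x}) :
    (nonDegenerateBasis R _ k).repr (G.wordChain R k c) (injWordEquivNonDegenerate G k x) =
      c.1 x := by
  rw [← injWordChainsEquiv_apply]
  change (nonDegenerateBasis R _ k).repr
    (((nonDegenerateBasis R _ k).reindex (injWordEquivNonDegenerate G k).symm).repr.symm _)
      ((injWordEquivNonDegenerate G k).symm.symm x) = _
  rw [← Module.Basis.repr_reindex_apply, LinearEquiv.apply_symm_apply]
  rfl

lemma d_wordChain {c : Tuples V R (k + 1)} (hc : c ∈ injWordChains G (k + 1) R) :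
    (G.injNerveComplex R).C.d (k + 1) k (G.wordChain R (k + 1) c) =
      G.wordChain R k (boundary V R k c) := by
  refine eqOn_supported (f := ((G.injNerveComplex R).C.d (k + 1) k).hom.comp _)
    (g := (G.wordChain R k).comp (boundary V R k)) (fun x hx => ?_) hc
  rw [LinearMap.comp_apply, wordChain_single G R hx]
  refine (d_simplexChain R _ _).trans ?_
  simp only [LinearMap.comp_apply, boundary_single, map_sum, map_smul]
  exact Finset.sum_congr rfl fun i _ =>
    congrArg _ (wordChain_single G R (isInjWord_comp_succAbove hx i)).symm

/-- The tuples of length at most `p`. -/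
def lenLE (k : ℕ) (p : ℤ) : Set (Fin (k + 1) → V) :=
  {x | ∃ n : ℕ, G.len x ≤ n ∧ (n : ℤ) ≤ p}

lemma wordChain_mem_F_iff {p : ℤ} {c : Tuples V R k} (hc : c ∈ injWordChains G k R) :
    G.wordChain R k c ∈ (G.injNerveComplex R).F p k ↔ c ∈ Finsupp.supported R R (lenLE G k p) := by
  refine (mem_range_normalizedChainComplexMap_ι_iff R _ (G.injLengthFiltration p) _).trans ?_
  simp only [Finsupp.mem_support_iff, (injWordEquivNonDegenerate G k).symm.forall_congr_left,
    Equiv.symm_symm, nonDegenerateBasis_repr_wordChain G R ⟨c, hc⟩]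
  exact ⟨fun h x hx => h ⟨x, hc hx⟩ (Finsupp.mem_support_iff.1 hx),
    fun h x hx => h (Finsupp.mem_support_iff.2 hx)⟩

end InjectiveWords

section Length

variable {V : Type u} {G : Digraph V}

lemma reachable_of_edist_ne_top {x y : V} (h : G.edist x y ≠ ⊤) : G.Reachable x y :=
  let ⟨n, hn, _⟩ := exists_hasWalk_of_edist_ne_top h
  ⟨n, hn⟩

lemma one_le_edist {x y : V} (h : x ≠ y) : 1 ≤ G.edist x y :=
  Order.one_le_iff_ne_zero.2 (edist_ne_zero h)

lemma edist_le_one_iff_adj {x y : V} (h : x ≠ y) : G.edist x y ≤ 1 ↔ G.Adj x y := by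
  refine ⟨fun hle => ?_, fun h => by simpa using edist_le (HasWalk.cons h (.nil y))⟩
  obtain ⟨n, hn, edist_eq⟩ := exists_hasWalk_of_edist_ne_top
    (hle.trans_lt (WithTop.coe_lt_top 1)).ne
  have hn_one : (1 : ℕ∞) = n := (le_antisymm hle (one_le_edist h)).symm.trans edist_eq
  obtain rfl : n = 1 := by exact_mod_cast hn_one.symm
  cases hn with
  | cons e w => cases w; exact e

variable {k : ℕ} {x : Fin (k + 1) → V}

lemma edist_le_len {i j : Fin (k + 1)} (hij : i ≤ j) : G.edist (x i) (x j) ≤ G.len x := by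
  have hle := G.len_comp_le x ![i, j] (Fin.monotone_iff_le_succ.2 fun t => by
    obtain rfl := Subsingleton.elim t 0
    exact hij)
  simpa [len] using hle

lemma isInjWord_of_len_ne_top (hx : Function.Injective x) (h : G.len x ≠ ⊤) : G.IsInjWord x :=
  ⟨hx, fun _ _ hij =>
    reachable_of_edist_ne_top ((edist_le_len hij.le).trans_lt h.lt_top).ne⟩

lemma one_le_edist_succ (hx : Function.Injective x) (i : Fin k) :
    1 ≤ G.edist (x i.castSucc) (x i.succ) :=
  one_le_edist fun h => Fin.castSucc_lt_succ.ne (hx h)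

lemma le_len (hx : Function.Injective x) : (k : ℕ∞) ≤ G.len x := by
  calc (k : ℕ∞) = ∑ _ : Fin k, 1 := by simp
    _ ≤ G.len x := Finset.sum_le_sum fun i _ => one_le_edist_succ hx i

lemma len_le_iff_forall_edist_le_one (hx : Function.Injective x) :
    G.len x ≤ k ↔ ∀ i : Fin k, G.edist (x i.castSucc) (x i.succ) ≤ 1 := by
  refine ⟨fun hle i => ?_, fun h => ?_⟩
  · by_contra! hi
    have le_edist (j : Fin k) :
        (1 + if j = i then 1 else 0 : ℕ∞) ≤ G.edist (x j.castSucc) (x j.succ) := by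
      split_ifs with hji
      · exact hji ▸ Order.add_one_le_of_lt hi
      · simpa using one_le_edist_succ hx j
    have succ_le : (k + 1 : ℕ∞) ≤ k :=
      calc (k + 1 : ℕ∞) = ∑ j : Fin k, (1 + if j = i then 1 else 0) := by
            simp [Finset.sum_add_distrib]
        _ ≤ G.len x := Finset.sum_le_sum fun j _ => le_edist j
        _ ≤ k := hle
    exact absurd succ_le (by norm_cast; omega)
  · calc G.len x ≤ ∑ _ : Fin k, 1 := Finset.sum_le_sum fun i _ => h i
      _ = k := by simp

lemma isStronglyRegularPath_iff_len_le (hx : Function.Injective x) :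
    G.IsStronglyRegularPath x ↔ G.len x ≤ k := by
  rw [len_le_iff_forall_edist_le_one hx]
  exact (and_iff_right hx).trans <| forall_congr' fun i =>
    (edist_le_one_iff_adj fun h => Fin.castSucc_lt_succ.ne (hx h)).symm

lemma mem_lenLE_natCast {l : ℕ} : x ∈ lenLE G k l ↔ G.len x ≤ l :=
  ⟨fun ⟨_, hn, hl⟩ => hn.trans (by exact_mod_cast hl), fun h => ⟨l, h, le_rfl⟩⟩

lemma mem_lenLE_sub_one {l : ℕ} : x ∈ lenLE G k (l - 1) ↔ G.len x < l := by
  constructor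
  · rintro ⟨n, hn, hl⟩
    exact hn.trans_lt (by exact_mod_cast (by omega : n < l))
  · intro h
    obtain ⟨n, hn⟩ := ENat.ne_top_iff_exists.1 (h.trans (WithTop.coe_lt_top l)).ne
    rw [← hn] at h
    have : n < l := by exact_mod_cast h
    exact ⟨n, hn.ge, by omega⟩

end Length

section LenProj

variable {V R : Type u} [CommRing R] {G : Digraph V} {l k : ℕ} {c : Tuples V R k}

open Classical in
lemma lenProj_eq_filter : G.lenProj R l k c = c.filter fun x => G.len x = l := by
  induction c using Finsupp.induction_linear with
  | zero => rw [map_zero, Finsupp.filter_zero]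
  | add c c' hc hc' => rw [map_add, hc, hc', Finsupp.filter_add]
  | single x a =>
    have single_eq_smul : Finsupp.single x a = a • Finsupp.single x (1 : R) := by
      rw [Finsupp.smul_single_one]
    rw [single_eq_smul, map_smul, lenProj_single, Finsupp.filter_smul]
    split_ifs with h
    · rw [Finsupp.filter_single_of_pos (fun x => G.len x = l) h]
    · rw [Finsupp.filter_single_of_neg (fun x => G.len x = l) h]

lemma lenProj_eq_zero_iff (hc : c ∈ Finsupp.supported R R (lenLE G k l)) :
    G.lenProj R l k c = 0 ↔ c ∈ Finsupp.supported R R (lenLE G k (l - 1)) := by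
  classical
  rw [lenProj_eq_filter, Finsupp.filter_eq_zero_iff, Finsupp.mem_supported]
  refine ⟨fun h x hx => mem_lenLE_sub_one.2 ((mem_lenLE_natCast.1 (hc hx)).lt_of_ne fun hl =>
    Finsupp.mem_support_iff.1 hx (h x hl)), fun h x hl => ?_⟩
  exact Finsupp.notMem_support_iff.1 fun hx => (mem_lenLE_sub_one.1 (h hx)).ne hl

lemma lenProj_mem_eulerianChains (hc : c ∈ injWordChains G k R) :
    G.lenProj R l k c ∈ G.eulerianChains R l k := by
  classical
  rw [lenProj_eq_filter]
  intro x hx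
  rw [Finset.mem_coe, Finsupp.support_filter, Finset.mem_filter] at hx
  exact ⟨(hc hx.1).1, hx.2⟩

lemma lenProj_of_mem_eulerianChains (hc : c ∈ G.eulerianChains R l k) :
    G.lenProj R l k c = c := by
  classical
  rw [lenProj_eq_filter, Finsupp.filter_eq_self_iff]
  exact fun x hx => (hc (Finsupp.mem_support_iff.2 hx)).2

lemma eulerianChains_le_lenLE : G.eulerianChains R l k ≤ Finsupp.supported R R (lenLE G k l) :=
  Finsupp.supported_mono fun _ hx => mem_lenLE_natCast.2 hx.2.le

lemma eulerianChains_le_injWordChains : G.eulerianChains R l k ≤ injWordChains G k R :=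
  Finsupp.supported_mono fun _ hx => isInjWord_of_len_ne_top hx.1 (hx.2 ▸ WithTop.coe_ne_top)

end LenProj

section Words

variable {V R : Type u} [CommRing R]

lemma subtype_tupleComplex_d {M : ∀ k, Submodule R (Tuples V R k)}
    {D : ∀ k, Tuples V R (k + 1) →ₗ[R] Tuples V R k} (hD : ∀ k, ∀ c ∈ M (k + 1), D k c ∈ M k)
    (hDD : ∀ k, ∀ c ∈ M (k + 2), D k (D (k + 1) c) = 0) (k : ℕ) (c : M (k + 1)) :
    (M k).subtype ((tupleComplex M D hD hDD).d (k + 1) k c) = D k ((M (k + 1)).subtype c) :=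
  congrArg (fun f => (M k).subtype (f.hom c)) <|
    ChainComplex.of_d (fun k => ModuleCat.of R (M k))
      (fun k => ModuleCat.ofHom ((D k).restrict (hD k))) k

variable (G : Digraph V)

variable {G} in
lemma eulerianIncl_mem {l k : ℕ} (c : (G.eulerianMagnitudeComplex R l).X k) :
    G.eulerianIncl R l k c ∈ G.eulerianChains R l k :=
  Subtype.property c

variable {G} in
lemma regularPathIncl_mem {k : ℕ} (c : (G.regularPathComplex R).X k) :
    G.regularPathIncl R k c ∈ G.regularOmega R k :=
  Subtype.property c

lemma eulerianIncl_d (l k : ℕ) (c : (G.eulerianMagnitudeComplex R l).X (k + 1)) :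
    G.eulerianIncl R l k ((G.eulerianMagnitudeComplex R l).d (k + 1) k c) =
      G.magnitudeBoundary R l k (G.eulerianIncl R l (k + 1) c) :=
  subtype_tupleComplex_d _ _ k c

lemma regularPathIncl_d (k : ℕ) (c : (G.regularPathComplex R).X (k + 1)) :
    G.regularPathIncl R k ((G.regularPathComplex R).d (k + 1) k c) =
      boundary V R k (G.regularPathIncl R (k + 1) c) :=
  subtype_tupleComplex_d _ _ k c

lemma injWordsIncl_d (k : ℕ) (c : (G.injWordsComplex R).X (k + 1)) :
    G.injWordsIncl R k ((G.injWordsComplex R).d (k + 1) k c) =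
      boundary V R k (G.injWordsIncl R (k + 1) c) :=
  subtype_tupleComplex_d (M := fun k => injWordChains G k R) _ _ k c

variable {G} {k : ℕ} {c : Tuples V R k}

lemma boundary_mem_injWordChains {c : Tuples V R (k + 1)} (hc : c ∈ injWordChains G (k + 1) R) :
    boundary V R k c ∈ injWordChains G k R :=
  boundary_mem_supported R (P := fun _ => {x | G.IsInjWord x})
    (fun _ _ hx => isInjWord_comp_succAbove hx) k c hc

lemma injWordChainsEquiv_symm_wordChain (hc : c ∈ injWordChains G k R) :
    (injWordChainsEquiv G k R).symm (G.wordChain R k c) = ⟨c, hc⟩ :=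
  (LinearEquiv.symm_apply_eq _).2 (injWordChainsEquiv_apply G R ⟨c, hc⟩).symm

lemma exists_wordChain_eq (x : (G.injNerveComplex R).C.X k) :
    ∃ c ∈ injWordChains G k R, G.wordChain R k c = x := by
  obtain ⟨c, rfl⟩ := (injWordChainsEquiv G k R).surjective x
  exact ⟨c.1, c.2, (injWordChainsEquiv_apply G R c).symm⟩

lemma wordChain_injOn : Set.InjOn (G.wordChain R k) (injWordChains G k R) :=
  fun c hc c' hc' h => congrArg Subtype.val <|
    (injWordChainsEquiv G k R).injective (a₁ := ⟨c, hc⟩) (a₂ := ⟨c', hc'⟩) <| by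
      simpa only [injWordChainsEquiv_apply] using h

end Words

section EulerianMagnitude

variable {V : Type u} {G : Digraph V} {R : Type u} [CommRing R] {l k : ℕ}

variable (G R l k) in
/-- The projection of the chains of length at most `l` to the eulerian magnitude chains of length
exactly `l`. -/
noncomputable def eulerianProj :
    (G.injNerveComplex R).F l k →ₗ[R] (G.eulerianMagnitudeComplex R l).X k :=
  (G.lenProj R l k).restrict (fun _ => lenProj_mem_eulerianChains) ∘ₗ
    (injWordChainsEquiv G k R).symm.toLinearMap ∘ₗ Submodule.subtype _

lemma eulerianIncl_eulerianProj {c : Tuples V R k} (hc : c ∈ injWordChains G k R)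
    (hF : G.wordChain R k c ∈ (G.injNerveComplex R).F l k) :
    G.eulerianIncl R l k (eulerianProj G R l k ⟨G.wordChain R k c, hF⟩) = G.lenProj R l k c :=
  congrArg (fun c : injWordChains G k R => G.lenProj R l k c)
    (injWordChainsEquiv_symm_wordChain hc)

lemma wordChain_eulerianIncl_mem_F (c : (G.eulerianMagnitudeComplex R l).X k) :
    G.wordChain R k (G.eulerianIncl R l k c) ∈ (G.injNerveComplex R).F l k :=
  (wordChain_mem_F_iff G R (eulerianChains_le_injWordChains (eulerianIncl_mem c))).2
    (eulerianChains_le_lenLE (eulerianIncl_mem c))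

lemma eulerianIncl_injective : Function.Injective (G.eulerianIncl R l k) :=
  Submodule.injective_subtype _

lemma eulerianProj_wordChain_eulerianIncl (c : (G.eulerianMagnitudeComplex R l).X k) :
    eulerianProj G R l k ⟨_, wordChain_eulerianIncl_mem_F c⟩ = c :=
  eulerianIncl_injective <|
    (eulerianIncl_eulerianProj (eulerianChains_le_injWordChains (eulerianIncl_mem c)) _).trans
      (lenProj_of_mem_eulerianChains (eulerianIncl_mem c))

lemma eulerianProj_eq_zero_iff (x : (G.injNerveComplex R).F l k) :
    eulerianProj G R l k x = 0 ↔ x.1 ∈ (G.injNerveComplex R).F (l - 1) k := by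
  obtain ⟨x, hx⟩ := x
  obtain ⟨c, hc, rfl⟩ := exists_wordChain_eq x
  rw [← map_eq_zero_iff _ eulerianIncl_injective, eulerianIncl_eulerianProj hc,
    lenProj_eq_zero_iff ((wordChain_mem_F_iff G R hc).1 hx), wordChain_mem_F_iff G R hc]

lemma d_eulerianProj (x : (G.injNerveComplex R).F l (k + 1)) :
    (G.eulerianMagnitudeComplex R l).d (k + 1) k (eulerianProj G R l (k + 1) x) =
      eulerianProj G R l k ⟨_, (G.injNerveComplex R).d_mem l (k + 1) k x.1 x.2⟩ := by
  obtain ⟨x, hx⟩ := x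
  obtain ⟨c, hc, rfl⟩ := exists_wordChain_eq x
  have len_le : c ∈ Finsupp.supported R R {x : Fin (k + 2) → V | G.len x ≤ l} :=
    Finsupp.supported_mono (fun _ => mem_lenLE_natCast.1) ((wordChain_mem_F_iff G R hc).1 hx)
  apply eulerianIncl_injective
  simp only [d_wordChain G R hc]
  rw [eulerianIncl_d, eulerianIncl_eulerianProj hc,
    eulerianIncl_eulerianProj (boundary_mem_injWordChains hc),
    magnitudeBoundary_eq _ _ _ _ _ (lenProj_mem_eulerianChains hc),
    lenProj_boundary_lenProj _ _ _ _ _ len_le]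

variable (G R l) in
/-- The eulerian magnitude complex of length `l` as the `l`-th graded piece of the filtered chains
of the injective nerve. -/
noncomputable def eulerianGradedPiece :
    (G.injNerveComplex R).GradedPiece l (G.eulerianMagnitudeComplex R l) where
  proj := eulerianProj G R l
  proj_surjective _ c := ⟨_, eulerianProj_wordChain_eulerianIncl c⟩
  proj_eq_zero_iff := eulerianProj_eq_zero_iff
  d_proj i j x := by
    by_cases hij : j + 1 = i
    · subst hij
      exact d_eulerianProj x
    · have d_eq_zero : (G.injNerveComplex R).C.d i j x.1 = 0 := by
        rw [(G.injNerveComplex R).C.shape _ _ hij]; rfl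
      rw [(G.eulerianMagnitudeComplex R l).shape _ _ hij]
      exact ((eulerianProj_eq_zero_iff _).2 (by simp only [d_eq_zero, zero_mem])).symm

theorem exists_eulerianMagnitudeHomology_iso (G : Digraph V) (R : Type u) [CommRing R] (k l : ℕ) :
    ∃ e : G.eulerianMagnitudeHomology R k l ≅ ((G.injNerveComplex R).page 1).X (l, k),
      ∀ z : (G.eulerianMagnitudeComplex R l).cycles k,
        ∃ w : (G.injNerveComplex R).Z 1 l k,
          w.1 = G.wordChain R k
            (G.eulerianIncl R l k ((G.eulerianMagnitudeComplex R l).iCycles k z)) ∧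
          e.hom ((G.eulerianMagnitudeComplex R l).homologyπ k z) =
            (G.injNerveComplex R).cls 1 l k w := by
  let P := eulerianGradedPiece G R l
  refine ⟨P.homologyIso k, fun z => ?_⟩
  have proj_eq := eulerianProj_wordChain_eulerianIncl
    ((G.eulerianMagnitudeComplex R l).iCycles k z)
  refine ⟨⟨_, (P.mem_Z_one_iff k ⟨_, wordChain_eulerianIncl_mem_F _⟩).2 fun j => ?_⟩, rfl,
    P.homologyIso_hom_homologyπ k z _ proj_eq.symm⟩
  exact (congrArg _ proj_eq).trans (d_iCycles_apply _ k j z)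

end EulerianMagnitude

section RegularPaths

variable {V : Type u} {G : Digraph V} {R : Type u} [CommRing R] {k : ℕ}

lemma stronglyRegularPaths_le_injWordChains :
    G.stronglyRegularPaths R k ≤ injWordChains G k R :=
  Finsupp.supported_mono fun _ hx => isInjWord_of_len_ne_top hx.1
    (((isStronglyRegularPath_iff_len_le hx.1).1 hx).trans_lt (WithTop.coe_lt_top k)).ne

lemma regularOmega_le_stronglyRegularPaths : G.regularOmega R k ≤ G.stronglyRegularPaths R k := by
  cases k with
  | zero => exact le_rfl
  | succ k => exact inf_le_left

lemma regularOmega_le_injWordChains : G.regularOmega R k ≤ injWordChains G k R :=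
  regularOmega_le_stronglyRegularPaths.trans stronglyRegularPaths_le_injWordChains

lemma wordChain_mem_F_self_iff {c : Tuples V R k} (hc : c ∈ injWordChains G k R) :
    G.wordChain R k c ∈ (G.injNerveComplex R).F k k ↔ c ∈ G.stronglyRegularPaths R k := by
  rw [wordChain_mem_F_iff G R hc]
  exact forall₂_congr fun x hx => mem_lenLE_natCast.trans
    (isStronglyRegularPath_iff_len_le (hc hx).1).symm

lemma wordChain_mem_Z_one_iff {c : Tuples V R k} (hc : c ∈ injWordChains G k R) :
    G.wordChain R k c ∈ (G.injNerveComplex R).Z 1 k k ↔ c ∈ G.regularOmega R k := by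
  cases k with
  | zero => exact FilteredComplex.mem_Z_zero_iff.trans (wordChain_mem_F_self_iff hc)
  | succ k =>
    rw [FilteredComplex.mem_Z_succ_iff, Nat.cast_succ, add_sub_cancel_right, d_wordChain G R hc,
      wordChain_mem_F_self_iff (boundary_mem_injWordChains hc), ← Nat.cast_succ,
      wordChain_mem_F_self_iff hc]
    rfl

variable (G R k) in
/-- The isomorphism between `Ω_k` and the diagonal term `Z^1_k` of the filtered chains of the
injective nerve. -/
noncomputable def regularPathEquivZ :
    (G.regularPathComplex R).X k ≃ₗ[R] (G.injNerveComplex R).Z 1 k k :=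
  LinearEquiv.ofBijective
    ((G.wordChain R k ∘ₗ G.regularPathIncl R k).codRestrict _ fun c =>
      (wordChain_mem_Z_one_iff (regularOmega_le_injWordChains (regularPathIncl_mem c))).2
        (regularPathIncl_mem c)) <| by
    constructor
    · exact fun c c' h => Subtype.ext <| wordChain_injOn
        (regularOmega_le_injWordChains (regularPathIncl_mem c))
        (regularOmega_le_injWordChains (regularPathIncl_mem c')) (Subtype.ext_iff.1 h)
    · rintro ⟨x, hx⟩
      obtain ⟨c, hc, rfl⟩ := exists_wordChain_eq x
      exact ⟨⟨c, (wordChain_mem_Z_one_iff hc).1 hx⟩, rfl⟩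

lemma coe_regularPathEquivZ (c : (G.regularPathComplex R).X k) :
    (regularPathEquivZ G R k c).1 = G.wordChain R k (G.regularPathIncl R k c) := rfl

lemma coe_regularPathEquivZ_d (c : (G.regularPathComplex R).X (k + 1)) :
    (regularPathEquivZ G R k ((G.regularPathComplex R).d (k + 1) k c)).1 =
      (G.injNerveComplex R).C.d (k + 1) k (regularPathEquivZ G R (k + 1) c).1 := by
  rw [coe_regularPathEquivZ, coe_regularPathEquivZ, regularPathIncl_d,
    d_wordChain G R (regularOmega_le_injWordChains (regularPathIncl_mem c))]

variable (G R) in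
lemma injNerveComplex_F_eq_bot (p : ℤ) (k : ℕ) (hp : p < k) :
    (G.injNerveComplex R).F p k = ⊥ := by
  refine (Submodule.eq_bot_iff _).2 fun x hx => ?_
  obtain ⟨c, hc, rfl⟩ := exists_wordChain_eq x
  have c_eq_zero : c = 0 := Finsupp.support_eq_empty.1 <| Finset.eq_empty_of_forall_notMem
    fun y hy => by
      obtain ⟨n, hn, hnp⟩ := (wordChain_mem_F_iff G R hc).1 hx hy
      have k_le : k ≤ n := by exact_mod_cast (le_len (hc hy).1).trans hn
      omega
  rw [c_eq_zero, map_zero]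

theorem exists_regularPathHomology_iso (G : Digraph V) (R : Type u) [CommRing R] (k : ℕ) :
    ∃ e : G.regularPathHomology R k ≅ ((G.injNerveComplex R).page 2).X (k, k),
      ∀ z : (G.regularPathComplex R).cycles k,
        ∃ w : (G.injNerveComplex R).Z 2 k k,
          w.1 = G.wordChain R k (G.regularPathIncl R k ((G.regularPathComplex R).iCycles k z)) ∧
          e.hom ((G.regularPathComplex R).homologyπ k z) = (G.injNerveComplex R).cls 2 k k w := by
  refine ⟨FilteredComplex.diagonalIso (injNerveComplex_F_eq_bot G R) (regularPathEquivZ G R)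
    (fun _ => coe_regularPathEquivZ_d) k, fun z => ?_⟩
  let c := (G.regularPathComplex R).iCycles k z
  have d_eq_zero : ∀ j, (G.injNerveComplex R).C.d k j (regularPathEquivZ G R k c).1 = 0 :=
    (FilteredComplex.d_diagonal_eq_zero_iff _ (fun _ => coe_regularPathEquivZ_d) k c).2 fun j =>
      d_iCycles_apply _ k j z
  exact ⟨⟨_, FilteredComplex.mem_Z_of_d_eq_zero (regularPathEquivZ G R k c).2.1 d_eq_zero⟩, rfl,
    FilteredComplex.diagonalIso_hom_homologyπ _ _ _ k z _ rfl⟩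

end RegularPaths

end MagnitudePath

namespace FilteredComplex

lemma map_homologyFiltration {R : Type u} [CommRing R] (A : FilteredComplex R)
    {K : ChainComplex (ModuleCat.{u} R) ℕ} (θ : K ≅ A.C) (k : ℕ) (p : ℤ) :
    (A.homologyFiltration k p).map (HomologicalComplex.homologyMap θ.inv k).hom =
      (((A.F p k).comap (θ.hom.f k).hom).comap (K.iCycles k).hom).map (K.homologyπ k).hom := by
  have cyclesMap_hom : (HomologicalComplex.cyclesMap θ.hom k) ≫ A.C.iCycles k =
      K.iCycles k ≫ θ.hom.f k := HomologicalComplex.cyclesMap_i _ _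
  have map_cyclesMap_inv (S : Submodule R (A.C.cycles k)) :
      S.map (HomologicalComplex.cyclesMap θ.inv k).hom =
        S.comap (HomologicalComplex.cyclesMap θ.hom k).hom :=
    Submodule.map_equiv_eq_comap_symm
      (HomologicalComplex.cyclesMapIso θ k).symm.toLinearEquiv S
  have homologyπ_comp := congrArg ModuleCat.Hom.hom
    (HomologicalComplex.homologyπ_naturality θ.inv k)
  have comp_iCycles := congrArg ModuleCat.Hom.hom cyclesMap_hom
  rw [ModuleCat.hom_comp, ModuleCat.hom_comp] at homologyπ_comp comp_iCycles
  rw [homologyFiltration, ← Submodule.map_comp, homologyπ_comp, Submodule.map_comp,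
    map_cyclesMap_inv, ← Submodule.comap_comp, comp_iCycles, Submodule.comap_comp]

end FilteredComplex

namespace MagnitudePath

open Digraph

section Convergence

variable {V : Type u} (G : Digraph V) (R : Type u) [CommRing R]

/-- The isomorphism between the complex of injective words and the normalized chain complex of the
injective nerve. -/
noncomputable def injWordsIso : G.injWordsComplex R ≅ (G.injNerveComplex R).C :=
  HomologicalComplex.Hom.isoOfComponents (fun k => (injWordChainsEquiv G k R).toModuleIso) <| by
    rintro _ k rfl
    refine ModuleCat.hom_ext (LinearMap.ext fun c => ?_)
    calc (G.injNerveComplex R).C.d (k + 1) k (injWordChainsEquiv G (k + 1) R c)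
      _ = (G.injNerveComplex R).C.d (k + 1) k
          (G.wordChain R (k + 1) (G.injWordsIncl R (k + 1) c)) :=
        congrArg _ (injWordChainsEquiv_apply G R c)
      _ = G.wordChain R k (boundary V R k (G.injWordsIncl R (k + 1) c)) :=
        d_wordChain G R (Subtype.property c)
      _ = G.wordChain R k (G.injWordsIncl R k ((G.injWordsComplex R).d (k + 1) k c)) :=
        congrArg _ (injWordsIncl_d G k c).symm
      _ = injWordChainsEquiv G k R ((G.injWordsComplex R).d (k + 1) k c) :=
        (injWordChainsEquiv_apply G R _).symm

lemma injWordsIso_hom_f (k : ℕ) (c : (G.injWordsComplex R).X k) :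
    (injWordsIso G R).hom.f k c = G.wordChain R k (G.injWordsIncl R k c) :=
  injWordChainsEquiv_apply G R c

lemma map_homologyFiltration_injNerveComplex (k : ℕ) (p : ℤ) :
    ((G.injNerveComplex R).homologyFiltration k p).map
      (HomologicalComplex.homologyMap (injWordsIso G R).inv k).hom =
        G.injWordsHomologyFiltration R k p := by
  have comap_F : ((G.injNerveComplex R).F p k).comap ((injWordsIso G R).hom.f k).hom =
      (Finsupp.supported R R (lenLE G k p)).comap (G.injWordsIncl R k) :=
    Submodule.ext fun c => (congrArg (· ∈ (G.injNerveComplex R).F p k)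
      (injWordsIso_hom_f G R k c)).to_iff.trans (wordChain_mem_F_iff G R (Subtype.property c))
  rw [FilteredComplex.map_homologyFiltration, comap_F]
  rfl

variable {G}

lemma len_le_of_isInjWord {D : ℕ} (hG : ∀ x y, G.Reachable x y → G.edist x y ≤ D) {k : ℕ}
    {x : Fin (k + 1) → V} (hx : G.IsInjWord x) : G.len x ≤ (k * D : ℕ) := by
  calc G.len x ≤ ∑ _ : Fin k, (D : ℕ∞) :=
        Finset.sum_le_sum fun i _ => hG _ _ (hx.2 _ _ Fin.castSucc_lt_succ)
    _ = (k * D : ℕ) := by simp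

lemma injNerveComplex_F_eq_top {D : ℕ} (hG : ∀ x y, G.Reachable x y → G.edist x y ≤ D) (k : ℕ) :
    (G.injNerveComplex R).F (k * D : ℕ) k = ⊤ := by
  refine (Submodule.eq_top_iff').2 fun x => ?_
  obtain ⟨c, hc, rfl⟩ := exists_wordChain_eq x
  exact (wordChain_mem_F_iff G R hc).2 fun y hy =>
    mem_lenLE_natCast.2 (len_le_of_isInjWord hG (hc hy))

theorem convergesTo_injWordsComplex_homology
    (hG : ∃ D : ℕ, ∀ x y, G.Reachable x y → G.edist x y ≤ D) :
    ConvergesTo (G.regularMagnitudePathSS R) (fun k => (G.injWordsComplex R).homology k)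
      (G.injWordsHomologyFiltration R) := by
  obtain ⟨D, hD⟩ := hG
  exact (FilteredComplex.convergesTo fun k => ⟨_, injNerveComplex_F_eq_top R hD k⟩).of_iso
    (fun k => HomologicalComplex.homologyMapIso (injWordsIso G R).symm k)
    (map_homologyFiltration_injNerveComplex G R)

lemma exists_edist_le_of_finite [Finite V] (G : Digraph V) :
    ∃ D : ℕ, ∀ x y, G.Reachable x y → G.edist x y ≤ D := by
  obtain ⟨D, hD⟩ := (Set.finite_range fun p : V × V => (G.edist p.1 p.2).toNat).bddAbove
  refine ⟨D, fun x y ⟨n, hn⟩ => ?_⟩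
  have edist_ne_top : G.edist x y ≠ ⊤ := ((edist_le hn).trans_lt (WithTop.coe_lt_top n)).ne
  rw [← ENat.natCast_toNat edist_ne_top]
  exact_mod_cast hD ⟨(x, y), rfl⟩

end Convergence

end MagnitudePath

open MagnitudePath in
theorem mainTheorem2_general {V R : Type u} [CommRing R] (G : Digraph V)
    (hG : ∃ D : ℕ, ∀ x y, G.Reachable x y → G.edist x y ≤ D) :
    (∀ k l : ℕ, ∃ e : G.eulerianMagnitudeHomology R k l ≅
        ((G.injNerveComplex R).page 1).X (l, k),
      ∀ z : (G.eulerianMagnitudeComplex R l).cycles k,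
        ∃ w : (G.injNerveComplex R).Z 1 l k,
          w.1 = G.wordChain R k
            (G.eulerianIncl R l k ((G.eulerianMagnitudeComplex R l).iCycles k z)) ∧
          e.hom ((G.eulerianMagnitudeComplex R l).homologyπ k z) =
            (G.injNerveComplex R).cls 1 l k w) ∧
    (∀ k : ℕ, ∃ e : G.regularPathHomology R k ≅ ((G.injNerveComplex R).page 2).X (k, k),
      ∀ z : (G.regularPathComplex R).cycles k,
        ∃ w : (G.injNerveComplex R).Z 2 k k,
          w.1 = G.wordChain R k (G.regularPathIncl R k ((G.regularPathComplex R).iCycles k z)) ∧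
          e.hom ((G.regularPathComplex R).homologyπ k z) = (G.injNerveComplex R).cls 2 k k w) ∧
    ((∃ θ : G.injWordsComplex R ≅ (G.injNerveComplex R).C,
        ∀ (k : ℕ) (c : (G.injWordsComplex R).X k),
          θ.hom.f k c = G.wordChain R k (G.injWordsIncl R k c)) ∧
      ConvergesTo (G.regularMagnitudePathSS R) (fun k => (G.injWordsComplex R).homology k)
        (G.injWordsHomologyFiltration R)) ∧
    (∃ φ : G.regularMagnitudePathSS R ⟶ G.magnitudePathSS R,
      ∀ (r : ℤ) (hr : 0 ≤ r) (l k : ℕ) (w : (G.injNerveComplex R).Z r l k),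
        (φ.hom r hr).f (l, k) ((G.injNerveComplex R).cls r l k w) =
          (G.nerveComplex R).cls r l k ((G.inclusionHom R).mapZ r l k w)) :=
  ⟨exists_eulerianMagnitudeHomology_iso G R, exists_regularPathHomology_iso G R,
    ⟨⟨injWordsIso G R, injWordsIso_hom_f G R⟩, convergesTo_injWordsComplex_homology R hG⟩,
    (G.inclusionHom R).mapSpectralSequence, fun _ _ _ _ _ => rfl⟩

theorem mainTheorem2 {V R : Type u} [Finite V] [CommRing R] (G : Digraph V) :
    -- the first page is the eulerian magnitude homology
    (∀ k l : ℕ, ∃ e : G.eulerianMagnitudeHomology R k l ≅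
        ((G.regularMagnitudePathSS R).page 1).X (l, k),
      ∀ z : (G.eulerianMagnitudeComplex R l).cycles k,
        ∃ w : (G.injNerveComplex R).Z 1 l k,
          w.1 = G.wordChain R k
            (G.eulerianIncl R l k ((G.eulerianMagnitudeComplex R l).iCycles k z)) ∧
          e.hom ((G.eulerianMagnitudeComplex R l).homologyπ k z) =
            (G.injNerveComplex R).cls 1 l k w) ∧
    -- the diagonal of the second page is the regular path homology
    (∀ k : ℕ, ∃ e : G.regularPathHomology R k ≅ ((G.regularMagnitudePathSS R).page 2).X (k, k),
      ∀ z : (G.regularPathComplex R).cycles k,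
        ∃ w : (G.injNerveComplex R).Z 2 k k,
          w.1 = G.wordChain R k (G.regularPathIncl R k ((G.regularPathComplex R).iCycles k z)) ∧
          e.hom ((G.regularPathComplex R).homologyπ k z) = (G.injNerveComplex R).cls 2 k k w) ∧
    -- the filtered complex computes the homology of the complex of injective words, to which the
    -- spectral sequence converges
    ((∃ θ : G.injWordsComplex R ≅ (G.injNerveComplex R).C,
        ∀ (k : ℕ) (c : (G.injWordsComplex R).X k),
          θ.hom.f k c = G.wordChain R k (G.injWordsIncl R k c)) ∧
      ConvergesTo (G.regularMagnitudePathSS R) (fun k => (G.injWordsComplex R).homology k)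
        (G.injWordsHomologyFiltration R)) ∧
    -- the inclusions of the filtration steps induce a map to the magnitude-path spectral sequence
    (∃ φ : G.regularMagnitudePathSS R ⟶ G.magnitudePathSS R,
      ∀ (r : ℤ) (hr : 0 ≤ r) (l k : ℕ) (w : (G.injNerveComplex R).Z r l k),
        (φ.hom r hr).f (l, k) ((G.injNerveComplex R).cls r l k w) =
          (G.nerveComplex R).cls r l k ((G.inclusionHom R).mapZ r l k w)) :=
  mainTheorem2_general G (MagnitudePath.exists_edist_le_of_finite G)
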